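/- Let $w_1\ge w_2\ge\dots\ge w_n$ be scores in $[w_{\min},w_{\max}]$ with $0<w_{\min}$ and $w_{\max}/w_{\min}\le b$, let $1\le K<n$, and let $\Delta_K:=(w_K-w_{K+1})/w_{\max}>0$. Let $\mathcal G=([n],\mathcal E)$ be an Erdős–Rényi random graph in which each pair is an edge independently with probability $p$. Conditionally on $\mathcal G$, for each edge $\{i,j\}\in\mathcal E$ with $i<j$ and each $1\le\ell\le L$, let $y^{(\ell)}_{ij}\in\{0,1\}$ be independent and equal to $1$ with probability $\frac{w_i}{w_i+w_j}$; put $y_{ij}:=\frac1L\sum_{\ell=1}^L y_{ij}^{(\ell)}$ and $y_{ji}:=1-y_{ij}$. Rank Centrality forms the matrix $\hat P$ with $\hat P_{ij}=\frac{1}{d_{\max}}y_{ij}$ if $\{i,j\}\in\mathcal E$, $\hat P_{jj}=1-\frac1{d_{\max}}\sum_{k:\{k,j\}\in\mathcal E}y_{kj}$, and all other entries $0$, where $d_{\max}$ is the maximum degree of $\mathcal G$; it computes the stationary distribution of $\hat P$ (the probability vector $v$ with $\hat Pv=v$) and returns the indices of its $K$ largest components. It is said to recover the top-$K$ set if the stationary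 distribution is unique and $\{1,\dots,K\}$ is the only set of $K$ indices of largest components. Theorem. There is an absolute constant $c_4>1$, and for every $b\ge1$ there are constants $c_5,c_6>0$ depending only on $b$, such that for all $n,K,L,p,w_{\min},w_{\max},w$ as above: if $$p\ge c_4\sqrt{\frac{\log n}{n}},\qquad L\ge\left\lceil c_5\,\frac{\log n}{np}\right\rceil,\qquad \frac{n^2pL}{2}\ge c_6\,\frac{n\log n}{\Delta_K^2},$$ then Rank Centrality recovers the top-$K$ set with probability at least $1-4n^{-\alpha}$, where $\alpha:=\min\left(1,\tfrac{3}{28}c_4^2\right)$. -/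

import Mathlib

open MeasureTheory ProbabilityTheory

noncomputable section

namespace TopKRanking

/-- The pairs `i < j` of items. -/
abbrev Pair (n : ℕ) : Type := {q : Fin n × Fin n // q.1 < q.2}

/-- The outcomes of all `L` comparisons of each pair `i < j`;
`true` means that item `i` is preferred over item `j`. -/
abbrev Comparisons (n L : ℕ) : Type := Pair n → Fin L → Bool

/-- The Bradley-Terry-Luce probability `w_i / (w_i + w_j)` that item `i` is preferred over item `j`,
as an element of the unit interval. The projection onto `[0, 1]` changes nothing for positive
scores, see `coe_btlProb`. -/
def btlProb {n : ℕ} (w : Fin n → ℝ) (i j : Fin n) : unitInterval :=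
  Set.projIcc 0 1 zero_le_one (w i / (w i + w j))

theorem coe_btlProb {n : ℕ} {w : Fin n → ℝ} (hw : ∀ i, 0 < w i) (i j : Fin n) :
    (btlProb w i j : ℝ) = w i / (w i + w j) := by
  have hi := hw i
  have hj := hw j
  have h0 : 0 ≤ w i / (w i + w j) := by positivity
  have h1 : w i / (w i + w j) ≤ 1 := by
    rw [div_le_one (by positivity)]
    linarith
  simp [btlProb, Set.projIcc_of_mem zero_le_one (show w i / (w i + w j) ∈ Set.Icc (0 : ℝ) 1 from
    ⟨h0, h1⟩)]

/-- The joint law of the comparison outcomes: all of them are independent, and each comparison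
of `i < j` is Bernoulli with success probability `w_i / (w_i + w_j)`. -/
def comparisonLaw {n : ℕ} (L : ℕ) (w : Fin n → ℝ) : Measure (Comparisons n L) :=
  Measure.pi fun q : Pair n => Measure.pi fun _ : Fin L =>
    bernoulliMeasure true false (btlProb w q.1.1 q.1.2)

/-- The joint law of an Erdős-Rényi comparison graph with edge probability `p` and of the
comparison outcomes. Outcomes are drawn, independently of the graph, for every pair; those of pairs
that are not edges are never looked at (see `transitionMatrix`). So, conditionally on the
graph, the observed outcomes are independent with the law of the Bradley-Terry-Luce model. -/
def observationLaw {n : ℕ} (L : ℕ) (p : unitInterval) (w : Fin n → ℝ) :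
    Measure (SimpleGraph (Fin n) × Comparisons n L) :=
  (SimpleGraph.binomialRandom (Fin n) p).prod (comparisonLaw L w)

/-- The fraction `y_ij` of the `L` comparisons of `i` and `j` in which `i` is preferred over `j`,
with `y_ji = 1 - y_ij`; the diagonal value is irrelevant. -/
def winRate {n L : ℕ} (y : Comparisons n L) (i j : Fin n) : ℝ :=
  if h : i < j then (∑ l : Fin L, if y ⟨(i, j), h⟩ l then (1 : ℝ) else 0) / L
  else if h : j < i then 1 - (∑ l : Fin L, if y ⟨(j, i), h⟩ l then (1 : ℝ) else 0) / L
  else 0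

open Classical in
/-- The (column-stochastic) transition matrix of Rank Centrality, built from the comparisons along
the edges of the comparison graph `G`. -/
def transitionMatrix {n L : ℕ} (G : SimpleGraph (Fin n)) (y : Comparisons n L) :
    Matrix (Fin n) (Fin n) ℝ :=
  Matrix.of fun i j =>
    if i = j then 1 - (1 / (G.maxDegree : ℝ)) * ∑ k with G.Adj k j, winRate y k j
    else if G.Adj i j then (1 / (G.maxDegree : ℝ)) * winRate y i j
    else 0

/-- `v` is a probability vector that is stationary for the column-stochastic matrix `P`. -/
def IsStationary {n : ℕ} (P : Matrix (Fin n) (Fin n) ℝ) (v : Fin n → ℝ) : Prop :=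
  v ∈ stdSimplex ℝ (Fin n) ∧ P.mulVec v = v

/-- `S` consists of the indices of `K` largest components of `v` (ties broken in any way). -/
def IsTopSet {n : ℕ} (v : Fin n → ℝ) (K : ℕ) (S : Finset (Fin n)) : Prop :=
  S.card = K ∧ ∀ i ∈ S, ∀ j ∉ S, v j ≤ v i

/-- Rank Centrality identifies the set of the first `K` items: the transition matrix has a
unique stationary distribution, and the only set of `K` indices with largest stationary mass is
the set of the first `K` indices (so the output is right however ties would be broken). -/
def RankCentralityRecovers {n L : ℕ} (K : ℕ) (G : SimpleGraph (Fin n)) (y : Comparisons n L) :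
    Prop :=
  ∃ v : Fin n → ℝ, IsStationary (transitionMatrix G y) v ∧
    (∀ v', IsStationary (transitionMatrix G y) v' → v' = v) ∧
    ∀ S, IsTopSet v K S → S = Finset.univ.filter fun i : Fin n => (i : ℕ) < K

/-- The separation `Δ_K = (w_K - w_{K+1}) / w_max`, for `1 ≤ K < n`. Indices start at `0` here, so
that `w_K` is `w ⟨K - 1, _⟩` and `w_{K+1}` is `w ⟨K, _⟩`. -/
def separation {n : ℕ} (w : Fin n → ℝ) (wmax : ℝ) (K : ℕ) (hK : K < n) : ℝ :=
  (w ⟨K - 1, lt_of_le_of_lt (Nat.sub_le K 1) hK⟩ - w ⟨K, hK⟩) / wmax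

end TopKRanking

end

noncomputable section

namespace TopKRanking

/-! The argument compares a stationary vector `u` with the scores through the ratio `r = u / w`.
Stationarity says that, at each `i`, the mass flowing in from neighbours equals `lossSum` times `u
i`; the scores satisfy the same equations up to `balanceError`. Hence `r` is almost harmonic for a
weighted walk on the graph, and the task is to show that its maximum `M` and minimum `m` nearly
agree.

At least half of the vertices lie on one side of `(M + m) / 2`. Let `g` be `M - r` or `r - m`,
chosen so that `g` is at least `(M - m) / 2` on such a half `B`. At the vertex where `g` vanishes,
the balance equation makes the sum of `g` over the strong neighbours `A` small. The balance
equations summed over `A` then see `B` through many strong edges, which forces `(M - m) / 2` to be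
small (`RegularObservation.lower_bound_le`). Two steps reach half of the vertices because `p` is at
least of order `√(log n / n)`. So `u` is proportional to `w` up to a relative error `δ`, and `δ < Δ`
preserves the order across the cut at `K` (`RegularObservation.recovers`).

What the graph and comparisons must satisfy is collected in `RegularObservation`. Its four
requirements are Chernoff bounds for sums over independent pairs; each fails with probability at
most `1 / n`. The expansion bound must survive a union over all `4 ^ n` pairs of sets, which is
where the density assumption enters. -/

/-! ### The random graph as a product of edge indicators -/

/-- The graph whose edges are the pairs marked `true`. -/
def graphOfPairs {n : ℕ} (x : Pair n → Bool) : SimpleGraph (Fin n) where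
  Adj i j := (∃ h : i < j, x ⟨(i, j), h⟩ = true) ∨ ∃ h : j < i, x ⟨(j, i), h⟩ = true
  symm := ⟨fun _ _ h => h.symm⟩
  loopless := ⟨fun _ h => by rcases h with ⟨h, _⟩ | ⟨h, _⟩ <;> exact lt_irrefl _ h⟩

theorem graphOfPairs_adj {n : ℕ} (x : Pair n → Bool) (q : Pair n) :
    (graphOfPairs x).Adj q.1.1 q.1.2 ↔ x q = true := by
  obtain ⟨⟨i, j⟩, h⟩ := q
  constructor
  · rintro (⟨_, hx⟩ | ⟨h', _⟩)
    · exact hx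
    · exact absurd h (lt_asymm h')
  · exact fun hx => Or.inl ⟨h, hx⟩

theorem graphOfPairs_eq_iff {n : ℕ} (x : Pair n → Bool) (G : SimpleGraph (Fin n)) :
    graphOfPairs x = G ↔ ∀ q : Pair n, x q = true ↔ G.Adj q.1.1 q.1.2 := by
  constructor
  · rintro rfl q
    exact (graphOfPairs_adj x q).symm
  · intro h
    have key : ∀ i j : Fin n, i < j → ((graphOfPairs x).Adj i j ↔ G.Adj i j) := fun i j hij =>
      (graphOfPairs_adj x ⟨(i, j), hij⟩).trans (h ⟨(i, j), hij⟩)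
    ext i j
    rcases lt_trichotomy i j with hij | rfl | hij
    · exact key i j hij
    · simp
    · rw [SimpleGraph.adj_comm, G.adj_comm]
      exact key j i hij

open Classical in
theorem card_pairs_adj {n : ℕ} (G : SimpleGraph (Fin n)) :
    (Finset.univ.filter fun q : Pair n => G.Adj q.1.1 q.1.2).card = G.edgeSet.ncard := by
  rw [← Set.ncard_coe_finset]
  refine Set.ncard_congr (fun q _ => s(q.1.1, q.1.2)) ?_ ?_ ?_
  · intro q hq
    simpa using hq
  · rintro ⟨⟨i, j⟩, h⟩ ⟨⟨k, l⟩, h'⟩ _ _ he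
    simp only [Sym2.eq_iff] at he
    simp only [Subtype.mk.injEq, Prod.mk.injEq]
    rcases he with he | he
    · exact he
    · obtain ⟨rfl, rfl⟩ := he
      exact absurd h (lt_asymm h')
  · intro e
    induction e with
    | _ i j =>
      intro he
      rcases lt_trichotomy i j with hij | rfl | hij
      · exact ⟨⟨(i, j), hij⟩, by simpa using he, rfl⟩
      · simp at he
      · exact ⟨⟨(j, i), hij⟩, by simpa using SimpleGraph.Adj.symm he, Sym2.eq_swap⟩

theorem card_pair (n : ℕ) : Fintype.card (Pair n) = n.choose 2 := by
  classical
  have h := card_pairs_adj (⊤ : SimpleGraph (Fin n))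
  calc Fintype.card (Pair n) = (⊤ : SimpleGraph (Fin n)).edgeSet.ncard := by
        rw [← h, ← Finset.card_univ]
        congr 1
        ext q
        simpa using q.2.ne
    _ = n.choose 2 := ?_
  rw [ ← SimpleGraph.coe_edgeFinset, Set.ncard_coe_finset,
    SimpleGraph.card_edgeFinset_top_eq_card_choose_two, Fintype.card_fin]

/-- The σ-algebra is pulled back along the injective map `Adj`. As there are finitely many graphs on
`Fin n`, all functions of the observations become measurable and integrable. -/
instance {V : Type*} [Countable V] : MeasurableSingletonClass (SimpleGraph V) where
  measurableSet_singleton G := by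
    refine ⟨{G.Adj}, measurableSet_singleton _, ?_⟩
    ext H
    exact SimpleGraph.adj_inj

/-- The edge indicators of a binomial random graph are independent Bernoulli variables. -/
theorem binomialRandom_eq_map_pi (n : ℕ) (p : unitInterval) :
    SimpleGraph.binomialRandom (Fin n) p =
      (Measure.pi fun _ : Pair n => bernoulliMeasure true false p).map graphOfPairs := by
  classical
  refine Measure.ext_of_singleton fun G => ?_
  rw [SimpleGraph.binomialRandom_singleton,
    Measure.map_apply (measurable_of_finite _) (MeasurableSet.singleton _)]
  have hpre : graphOfPairs ⁻¹' {G} = {fun q : Pair n => decide (G.Adj q.1.1 q.1.2)} := by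
    ext x
    simp only [Set.mem_preimage, Set.mem_singleton_iff, graphOfPairs_eq_iff, funext_iff]
    refine forall_congr' fun q => ?_
    by_cases h : G.Adj q.1.1 q.1.2 <;> simp [h]
  rw [hpre, Measure.pi_singleton]
  have hval : ∀ q : Pair n, bernoulliMeasure true false p {decide (G.Adj q.1.1 q.1.2)} =
      if G.Adj q.1.1 q.1.2 then (unitInterval.toNNReal p : ENNReal)
        else unitInterval.toNNReal (unitInterval.symm p) := by
    intro q
    rw [bernoulliMeasure_apply p (MeasurableSet.singleton _)]
    by_cases h : G.Adj q.1.1 q.1.2 <;> simp [h]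
  simp_rw [hval]
  rw [Finset.prod_ite, Finset.prod_const, Finset.prod_const, card_pairs_adj, Finset.filter_not,
    Finset.card_sdiff_of_subset (Finset.filter_subset _ _), card_pairs_adj, Finset.card_univ, card_pair,
    Nat.card_eq_fintype_card, Fintype.card_fin]

instance {n : ℕ} (L : ℕ) (w : Fin n → ℝ) : IsProbabilityMeasure (comparisonLaw L w) := by
  unfold comparisonLaw
  infer_instance

instance {n : ℕ} (L : ℕ) (p : unitInterval) (w : Fin n → ℝ) :
    IsProbabilityMeasure (observationLaw L p w) := by
  unfold observationLaw
  infer_instance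

/-! ### Independence across pairs and Chernoff bounds -/

/-- The law of the `L` comparisons of one pair. -/
abbrev pairLaw {n : ℕ} (L : ℕ) (w : Fin n → ℝ) (q : Pair n) : Measure (Fin L → Bool) :=
  Measure.pi fun _ : Fin L => bernoulliMeasure true false (btlProb w q.1.1 q.1.2)

open Classical in
/-- The data attached to distinct pairs are independent. -/
theorem integral_prod_pairs {n L : ℕ} (p : unitInterval) (w : Fin n → ℝ)
    (f : Pair n → Bool → (Fin L → Bool) → ℝ) :
    ∫ ω, ∏ q, f q (decide (ω.1.Adj q.1.1 q.1.2)) (ω.2 q) ∂(observationLaw L p w) =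
      ∏ q, ∫ z, ((p : ℝ) * f q true z + (1 - p) * f q false z) ∂(pairLaw L w q) := by
  unfold observationLaw
  -- The graph is integrated out first, with the comparisons frozen, so that each pair contributes
  -- its own two-point average.
  rw [integral_prod_symm _ (Integrable.of_finite)]
  have inner : ∀ y : Comparisons n L,
      ∫ G, ∏ q : Pair n, f q (decide (G.Adj q.1.1 q.1.2)) (y q)
        ∂(SimpleGraph.binomialRandom (Fin n) p) =
      ∏ q, ((p : ℝ) * f q true (y q) + (1 - p) * f q false (y q)) := by
    intro y
    rw [binomialRandom_eq_map_pi, integral_map (measurable_of_finite _).aemeasurable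
      (measurable_of_finite _).aestronglyMeasurable]
    simp_rw [graphOfPairs_adj, Bool.decide_eq_true]
    rw [integral_fintype_prod_eq_prod (f := fun q x => f q x (y q))]
    simp [integral_bernoulliMeasure]
  simp_rw [inner]
  unfold comparisonLaw
  rw [integral_fintype_prod_eq_prod
    (f := fun q z => (p : ℝ) * f q true z + (1 - p) * f q false z)]

open Classical in
/-- Chernoff's bound for a sum over the edges of functions of the comparisons along them. -/
theorem measure_sum_edges_ge_le {n L : ℕ} (p : unitInterval) (w : Fin n → ℝ)
    (g : Pair n → (Fin L → Bool) → ℝ) (c : Pair n → ℝ)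
    (hg : ∀ q, ∫ z, Real.exp (g q z) ∂(pairLaw L w q) ≤ 1 + c q) (t : ℝ) :
    (observationLaw L p w).real
        {ω | t ≤ ∑ q : Pair n, if ω.1.Adj q.1.1 q.1.2 then g q (ω.2 q) else 0} ≤
      Real.exp (p * ∑ q, c q - t) := by
  have hp0 : (0 : ℝ) ≤ p := p.2.1
  have hmgf : mgf (fun ω : SimpleGraph (Fin n) × Comparisons n L =>
      ∑ q : Pair n, if ω.1.Adj q.1.1 q.1.2 then g q (ω.2 q) else 0) (observationLaw L p w) 1 ≤
        Real.exp (p * ∑ q, c q) := by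
    have h1 : ∀ ω : SimpleGraph (Fin n) × Comparisons n L,
        Real.exp (1 * ∑ q : Pair n, if ω.1.Adj q.1.1 q.1.2 then g q (ω.2 q) else 0) =
        ∏ q : Pair n, (fun q (x : Bool) z => if x then Real.exp (g q z) else 1) q
          (decide (ω.1.Adj q.1.1 q.1.2)) (ω.2 q) := by
      intro ω
      rw [one_mul, Real.exp_sum]
      refine Finset.prod_congr rfl fun q _ => ?_
      by_cases h : ω.1.Adj q.1.1 q.1.2 <;> simp [h]
    rw [mgf]
    simp_rw [h1]
    rw [integral_prod_pairs p w (fun q (x : Bool) z => if x then Real.exp (g q z) else 1),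
      Finset.mul_sum, Real.exp_sum]
    refine Finset.prod_le_prod (fun q _ => ?_) (fun q _ => ?_)
    · refine integral_nonneg fun z => ?_
      have h2 : (0 : ℝ) ≤ 1 - p := by linarith [p.2.2]
      have := (Real.exp_pos (g q z)).le
      simp only [if_true, Bool.false_eq_true, if_false, Pi.zero_apply]
      positivity
    · simp only [if_true, Bool.false_eq_true, if_false]
      rw [integral_add Integrable.of_finite Integrable.of_finite, integral_const_mul,
        integral_const]
      simp only [probReal_univ, one_smul, mul_one]
      have := mul_le_mul_of_nonneg_left (hg q) hp0
      -- A pair contributes at most `p * (1 + c q) + (1 - p) = 1 + p * c q`, which is at most `exp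
      -- (p * c q)`.
      have := Real.add_one_le_exp (p * c q)
      linarith
  have := measure_ge_le_exp_mul_mgf (μ := observationLaw L p w)
    (X := fun ω : SimpleGraph (Fin n) × Comparisons n L =>
      ∑ q : Pair n, if ω.1.Adj q.1.1 q.1.2 then g q (ω.2 q) else 0) t zero_le_one
      Integrable.of_finite
  refine this.trans ?_
  rw [sub_eq_neg_add, Real.exp_add, neg_mul, one_mul]
  exact mul_le_mul_of_nonneg_left hmgf (Real.exp_pos _).le

/-- A sum over ordered pairs of distinct items, collected by unordered pairs. -/
theorem sum_sum_eq_sum_pairs {n : ℕ} (F : Fin n → Fin n → ℝ) (hF : ∀ i, F i i = 0) :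
    ∑ i, ∑ j, F i j = ∑ q : Pair n, (F q.1.1 q.1.2 + F q.1.2 q.1.1) := by
  classical
  have h1 : ∀ H : Fin n → Fin n → ℝ,
      ∑ q : Pair n, H q.1.1 q.1.2 = ∑ i, ∑ j, if i < j then H i j else 0 := by
    intro H
    rw [← Fintype.sum_prod_type' (f := fun i j => if i < j then H i j else 0),
      ← Finset.sum_filter]
    exact (Finset.sum_subtype _ (by simp) (fun a : Fin n × Fin n => H a.1 a.2)).symm
  rw [Finset.sum_add_distrib, h1, h1 fun i j => F j i, Finset.sum_comm (f := fun i j =>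
    if i < j then F j i else 0), ← Finset.sum_add_distrib]
  refine Finset.sum_congr rfl fun i _ => ?_
  rw [← Finset.sum_add_distrib]
  refine Finset.sum_congr rfl fun j _ => ?_
  rcases lt_trichotomy i j with h | rfl | h
  · simp [h, lt_asymm h]
  · simp [hF]
  · simp [h, lt_asymm h]

/-! ### Win rates of a single pair -/

/-- The fraction of successes among `L` comparisons. -/
def successRate {L : ℕ} (z : Fin L → Bool) : ℝ :=
  (∑ l : Fin L, if z l then (1 : ℝ) else 0) / L

theorem successRate_mem_Icc {L : ℕ} (z : Fin L → Bool) : successRate z ∈ Set.Icc (0 : ℝ) 1 := by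
  have h1 : (∑ l : Fin L, if z l then (1 : ℝ) else 0) ≤ L := by
    calc _ ≤ ∑ _l : Fin L, (1 : ℝ) := Finset.sum_le_sum fun l _ => by split_ifs <;> norm_num
      _ = L := by simp
  exact ⟨div_nonneg (Finset.sum_nonneg fun l _ => by split_ifs <;> norm_num) (Nat.cast_nonneg _),
    div_le_one_of_le₀ h1 (Nat.cast_nonneg _)⟩

theorem winRate_fst_snd {n L : ℕ} (y : Comparisons n L) (q : Pair n) :
    winRate y q.1.1 q.1.2 = successRate (y q) := by
  simp [winRate, successRate, q.2]

theorem winRate_snd_fst {n L : ℕ} (y : Comparisons n L) (q : Pair n) :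
    winRate y q.1.2 q.1.1 = 1 - successRate (y q) := by
  simp [winRate, successRate, q.2, lt_asymm q.2]

open Classical in
/-- Chernoff's bound for a sum over ordered adjacent pairs of functions of the win rates. -/
theorem measure_sum_adj_ge_le {n L : ℕ} (p : unitInterval) (w : Fin n → ℝ)
    (φ : Fin n → Fin n → ℝ → ℝ) (c : Fin n → Fin n → ℝ) (hc : ∀ i, c i i = 0)
    (hφ : ∀ q : Pair n, ∫ z, Real.exp (φ q.1.1 q.1.2 (successRate z) +
      φ q.1.2 q.1.1 (1 - successRate z)) ∂(pairLaw L w q) ≤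
        1 + (c q.1.1 q.1.2 + c q.1.2 q.1.1)) (t : ℝ) :
    (observationLaw L p w).real
        {ω | t ≤ ∑ i, ∑ j, if ω.1.Adj i j then φ i j (winRate ω.2 i j) else 0} ≤
      Real.exp (p * ∑ i, ∑ j, c i j - t) := by
  rw [sum_sum_eq_sum_pairs c hc]
  convert measure_sum_edges_ge_le p w (fun q z => φ q.1.1 q.1.2 (successRate z) +
      φ q.1.2 q.1.1 (1 - successRate z)) (fun q => c q.1.1 q.1.2 + c q.1.2 q.1.1) hφ t using 5
    with ω
  rw [sum_sum_eq_sum_pairs _ (by simp)]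
  refine Finset.sum_congr rfl fun q _ => ?_
  by_cases h : ω.1.Adj q.1.1 q.1.2
  · simp [h, h.symm, winRate_fst_snd, winRate_snd_fst]
  · simp [h, mt SimpleGraph.Adj.symm h]

/-- Hoeffding's lemma for the success rate of independent Bernoulli trials. -/
theorem integral_exp_successRate_le {L : ℕ} (hL : 1 ≤ L) (r : unitInterval) (s : ℝ) :
    ∫ z, Real.exp (s * (successRate z - r))
        ∂(Measure.pi fun _ : Fin L => bernoulliMeasure true false r) ≤
      Real.exp (s ^ 2 / (8 * L)) := by
  have hL0 : (0 : ℝ) < L := by exact_mod_cast hL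
  set X : Bool → ℝ := fun x => (if x then (1 : ℝ) else 0) - r with hX
  have hsplit : ∀ z : Fin L → Bool, Real.exp (s * (successRate z - r)) =
      ∏ l, Real.exp (s / L * X (z l)) := by
    intro z
    rw [← Real.exp_sum, ← Finset.mul_sum, hX, Finset.sum_sub_distrib]
    congr 1
    simp only [successRate, Finset.sum_const, Finset.card_univ, Fintype.card_fin, nsmul_eq_mul]
    field_simp
  simp_rw [hsplit]
  rw [integral_fintype_prod_eq_prod (f := fun _ x => Real.exp (s / L * X x)), Finset.prod_const,
    Finset.card_univ, Fintype.card_fin]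
  have hmean : ∫ x, X x ∂(bernoulliMeasure true false r) = 0 := by
    rw [integral_bernoulliMeasure]
    simp [hX]
    ring
  have hr := r.2
  -- A centred Bernoulli variable ranges over an interval of length `1`, so its variance proxy is `1
  -- / 4`.
  have hsub := hasSubgaussianMGF_of_mem_Icc_of_integral_eq_zero
    (μ := bernoulliMeasure true false r) (X := X) (a := -(r : ℝ)) (b := 1 - r)
    (measurable_of_finite _).aemeasurable (Filter.Eventually.of_forall fun x => by
      cases x <;> simp [hX]) hmean
  have hle := hsub.mgf_le (s / L)
  rw [mgf] at hle
  have hc : (((‖(1 - r : ℝ) - -(r : ℝ)‖₊ / 2) ^ 2 : NNReal) : ℝ) = 1 / 4 := by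
    rw [show (1 - r : ℝ) - -(r : ℝ) = 1 by ring]
    simp
    norm_num
  rw [hc] at hle
  calc _ ≤ (Real.exp (1 / 4 * (s / L) ^ 2 / 2)) ^ L :=
        pow_le_pow_left₀ (integral_nonneg fun x => (Real.exp_pos _).le) hle L
    _ = Real.exp (s ^ 2 / (8 * L)) := by
        rw [← Real.exp_nat_mul]
        congr 1
        field_simp
        ring

theorem integral_successRate {L : ℕ} (hL : 1 ≤ L) (r : unitInterval) :
    ∫ z, successRate z ∂(Measure.pi fun _ : Fin L => bernoulliMeasure true false r) = r := by
  have hL0 : (L : ℝ) ≠ 0 := by exact_mod_cast (Nat.one_le_iff_ne_zero.mp hL)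
  have h1 : ∀ l : Fin L, ∫ z : Fin L → Bool, (if z l then (1 : ℝ) else 0)
      ∂(Measure.pi fun _ : Fin L => bernoulliMeasure true false r) = r := by
    intro l
    rw [integral_comp_eval (μ := fun _ : Fin L => bernoulliMeasure true false r) (i := l)
      (f := fun x => if x then (1 : ℝ) else 0) (measurable_of_finite _).aestronglyMeasurable,
      integral_bernoulliMeasure]
    simp
  simp only [successRate]
  rw [integral_div, integral_finsetSum _ (fun _ _ => Integrable.of_finite)]
  simp only [h1, Finset.sum_const, Finset.card_univ, Fintype.card_fin, nsmul_eq_mul]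
  field_simp

/-- A random variable in `[0, 1]` with mean at least `2 θ` exceeds `θ` with probability at
least `θ`. -/
theorem le_measure_ge_of_two_mul_le_integral {Ω : Type*} [MeasurableSpace Ω] [Finite Ω]
    [MeasurableSingletonClass Ω] (μ : Measure Ω) [IsProbabilityMeasure μ] (X : Ω → ℝ)
    (hX : ∀ ω, X ω ≤ 1) {θ : ℝ} (hθ : 0 ≤ θ) (hm : 2 * θ ≤ ∫ ω, X ω ∂μ) :
    θ ≤ μ.real {ω | θ ≤ X ω} := by
  have h : ∫ ω, X ω ∂μ ≤ ∫ ω, (θ + Set.indicator {ω | θ ≤ X ω} (fun _ => (1 : ℝ)) ω) ∂μ := by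
    refine integral_mono Integrable.of_finite Integrable.of_finite fun ω => ?_
    by_cases hω : θ ≤ X ω
    · simp only [Set.indicator, Set.mem_ofPred_eq, hω, if_true]
      linarith [hX ω]
    · simp only [Set.indicator, Set.mem_ofPred_eq, hω, if_false]
      linarith
  rw [integral_add Integrable.of_finite Integrable.of_finite, integral_const,
    integral_indicator (Set.toFinite _).measurableSet] at h
  simp only [probReal_univ, integral_const, measureReal_restrict_apply_univ, smul_eq_mul,
    mul_one] at h
  linarith

/-- With probability at least `ρ`, both items of the pair `q` win a fraction at least `θ` of their
comparisons (each of the two events separately). -/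
def PairBalanced {n : ℕ} (L : ℕ) (w : Fin n → ℝ) (θ ρ : ℝ) (q : Pair n) : Prop :=
  ρ ≤ (pairLaw L w q).real {z | θ ≤ successRate z} ∧
    ρ ≤ (pairLaw L w q).real {z | θ ≤ 1 - successRate z}

/-- This version works for every `L ≥ 1`, even a single comparison, at the price of a success
probability `ρ = θ` that depends on `b`. -/
theorem pairBalanced_self {n L : ℕ} (hL : 1 ≤ L) {w : Fin n → ℝ} {θ : ℝ} (hθ : 0 ≤ θ) (q : Pair n)
    (h1 : 2 * θ ≤ btlProb w q.1.1 q.1.2) (h2 : 2 * θ ≤ 1 - (btlProb w q.1.1 q.1.2 : ℝ)) :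
    PairBalanced L w θ θ q := by
  constructor
  · exact le_measure_ge_of_two_mul_le_integral _ _ (fun z => (successRate_mem_Icc z).2) hθ
      (by rwa [integral_successRate hL])
  · refine le_measure_ge_of_two_mul_le_integral _ _
      (fun z => by linarith [(successRate_mem_Icc z).1]) hθ ?_
    rw [integral_sub Integrable.of_finite Integrable.of_finite, integral_successRate hL]
    simpa using h2

/-- A lower-tail Chernoff bound with the optimal tilt `s = -4 v θ` for a deviation `θ` below the
mean. The failure probability is at most `exp (-2 v θ ^ 2) ≤ exp (-1) < 1 / 2`. -/
theorem half_le_measure_ge_of_integral_exp_le {Ω : Type*} [MeasurableSpace Ω] [Finite Ω]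
    [MeasurableSingletonClass Ω] (μ : Measure Ω) [IsProbabilityMeasure μ] (X : Ω → ℝ)
    {m θ v : ℝ} (hv : 0 < v) (hm : 2 * θ ≤ m) (hθ : 0 < θ)
    (hX : ∀ s, ∫ ω, Real.exp (s * (X ω - m)) ∂μ ≤ Real.exp (s ^ 2 / (8 * v)))
    (hvθ : 1 ≤ 2 * v * θ ^ 2) :
    1 / 2 ≤ μ.real {ω | θ ≤ X ω} := by
  have h : ∫ ω, (1 - Real.exp (-(4 * v * θ) * (X ω - m) - 4 * v * θ ^ 2)) ∂μ ≤
      ∫ ω, Set.indicator {ω | θ ≤ X ω} (fun _ => (1 : ℝ)) ω ∂μ := by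
    refine integral_mono Integrable.of_finite Integrable.of_finite fun ω => ?_
    by_cases hω : θ ≤ X ω
    · simp only [Set.indicator, Set.mem_ofPred_eq, hω, if_true]
      linarith [Real.exp_pos (-(4 * v * θ) * (X ω - m) - 4 * v * θ ^ 2)]
    · simp only [Set.indicator, Set.mem_ofPred_eq, hω, if_false]
      have : 0 ≤ -(4 * v * θ) * (X ω - m) - 4 * v * θ ^ 2 := by
        push Not at hω
        have : 0 ≤ 4 * v * θ * (m - X ω - θ) := by
          apply mul_nonneg (by positivity)
          linarith
        linarith
      linarith [Real.one_le_exp this]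
  rw [integral_sub Integrable.of_finite Integrable.of_finite, integral_const,
    integral_indicator (Set.toFinite _).measurableSet] at h
  have h2 : ∫ ω, Real.exp (-(4 * v * θ) * (X ω - m) - 4 * v * θ ^ 2) ∂μ ≤ 1 / 2 := by
    simp_rw [sub_eq_add_neg (-(4 * v * θ) * _), Real.exp_add]
    rw [integral_mul_const]
    calc _ ≤ Real.exp ((-(4 * v * θ)) ^ 2 / (8 * v)) * Real.exp (-(4 * v * θ ^ 2)) :=
          mul_le_mul_of_nonneg_right (hX _) (Real.exp_pos _).le
      _ = Real.exp (-(2 * v * θ ^ 2)) := by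
          rw [← Real.exp_add]
          congr 1
          field_simp
          ring
      _ ≤ Real.exp (-1) := Real.exp_le_exp.mpr (by linarith)
      _ ≤ 1 / 2 := by linarith [Real.exp_neg_one_lt_half]
  simp only [probReal_univ, integral_const, measureReal_restrict_apply_univ, smul_eq_mul,
    mul_one] at h
  linarith

/-- Concentration over many comparisons replaces `ρ = θ` by an absolute constant; this serves the
small values of `n`, for which the density bound leaves no room for a `ρ` depending on `b`. -/
theorem pairBalanced_half {n L : ℕ} (hL : 1 ≤ L) {w : Fin n → ℝ} {θ : ℝ} (hθ : 0 < θ) (q : Pair n)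
    (h1 : 2 * θ ≤ btlProb w q.1.1 q.1.2) (h2 : 2 * θ ≤ 1 - (btlProb w q.1.1 q.1.2 : ℝ))
    (hLθ : 1 ≤ 2 * L * θ ^ 2) :
    PairBalanced L w θ (1 / 2) q := by
  have hL0 : (0 : ℝ) < L := by exact_mod_cast hL
  constructor
  · exact half_le_measure_ge_of_integral_exp_le _ _ hL0 h1 hθ
      (fun s => integral_exp_successRate_le hL _ s) hLθ
  · refine half_le_measure_ge_of_integral_exp_le _ _ hL0 h2 hθ (fun s => ?_) hLθ
    have := integral_exp_successRate_le hL (btlProb w q.1.1 q.1.2) (-s)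
    rw [neg_sq] at this
    refine le_trans (le_of_eq ?_) this
    congr 1
    ext z
    congr 1
    ring

/-! ### Concentration of strong edges, degrees and balance errors -/

open Classical in
/-- The number of ordered adjacent pairs in `A × B` whose win rate is at least `θ`. -/
def strongPairs {n L : ℕ} (θ : ℝ) (G : SimpleGraph (Fin n)) (y : Comparisons n L)
    (A B : Finset (Fin n)) : ℝ :=
  ∑ i, ∑ j, if G.Adj i j then (if i ∈ A ∧ j ∈ B ∧ θ ≤ winRate y i j then (1 : ℝ) else 0) else 0

/-- The loss of `1` pays for the diagonal, since `A` and `B` may overlap. -/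
theorem card_mul_card_sub_le {n : ℕ} (A B : Finset (Fin n)) :
    (A.card : ℝ) * (B.card - 1) ≤ ∑ i, ∑ j, if i ≠ j ∧ i ∈ A ∧ j ∈ B then (1 : ℝ) else 0 := by
  have h1 : ∀ i ∈ A, (B.card : ℝ) - 1 ≤ ∑ j, if i ≠ j ∧ i ∈ A ∧ j ∈ B then (1 : ℝ) else 0 := by
    intro i hi
    rw [← Finset.sum_filter, Finset.sum_const, nsmul_eq_mul, mul_one]
    have : (Finset.univ.filter fun j => i ≠ j ∧ i ∈ A ∧ j ∈ B) = B.erase i := by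
      ext j
      simp [hi, eq_comm]
    rw [this]
    have := Finset.pred_card_le_card_erase (s := B) (a := i)
    have : B.card ≤ (B.erase i).card + 1 := by omega
    have : (B.card : ℝ) ≤ (B.erase i).card + 1 := by exact_mod_cast this
    linarith
  calc (A.card : ℝ) * (B.card - 1) = ∑ i ∈ A, ((B.card : ℝ) - 1) := by
        rw [Finset.sum_const, nsmul_eq_mul]
    _ ≤ ∑ i ∈ A, ∑ j, if i ≠ j ∧ i ∈ A ∧ j ∈ B then (1 : ℝ) else 0 := Finset.sum_le_sum h1
    _ ≤ _ := Finset.sum_le_sum_of_subset_of_nonneg (Finset.subset_univ A) fun i _ _ =>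
        Finset.sum_nonneg fun j _ => by split_ifs <;> norm_num

/-- A lower-tail Chernoff bound with tilt `1 / 2`. The two orientations of a pair depend on the same
comparisons, so they are decoupled by convexity rather than by independence. -/
theorem measure_strongPairs_le {n L : ℕ} (p : unitInterval) (w : Fin n → ℝ) {θ ρ : ℝ}
    (hρ : 0 ≤ ρ) (hbal : ∀ q, PairBalanced L w θ ρ q) (A B : Finset (Fin n)) (t : ℝ) :
    (observationLaw L p w).real {ω | strongPairs θ ω.1 ω.2 A B ≤ t} ≤
      Real.exp (t / 2 - p * ρ * (A.card * (B.card - 1)) / 4) := by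
  classical
  have hp0 : (0 : ℝ) ≤ p := p.2.1
  have hexp : ∀ (P : Prop) [Decidable P], Real.exp (-(if P then (1 : ℝ) else 0)) ≤
      1 - (if P then (1 : ℝ) else 0) / 2 := by
    intro P _
    split_ifs
    · linarith [Real.exp_neg_one_lt_half]
    · simp
  have hprob : ∀ q : Pair n, ∀ X : (Fin L → Bool) → ℝ, ∀ (P Q : Prop) [Decidable P] [Decidable Q],
      ρ ≤ (pairLaw L w q).real {z | θ ≤ X z} →
      (if P ∧ Q then ρ else 0) ≤
        ∫ z, (if P ∧ Q ∧ θ ≤ X z then (1 : ℝ) else 0) ∂(pairLaw L w q) := by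
    intro q X P Q _ _ h
    by_cases hP : P ∧ Q
    · rw [if_pos hP]
      refine h.trans (le_of_eq ?_)
      rw [← integral_indicator_one (Set.toFinite _).measurableSet]
      congr 1
      ext z
      simp [Set.indicator, hP.1, hP.2]
    · rw [if_neg hP]
      exact integral_nonneg fun z => by dsimp only; split_ifs <;> norm_num
  have key := measure_sum_adj_ge_le (L := L) p w
    (fun i j x => -(1 / 2) * (if i ∈ A ∧ j ∈ B ∧ θ ≤ x then (1 : ℝ) else 0))
    (fun i j => -(ρ / 4) * (if i ≠ j ∧ i ∈ A ∧ j ∈ B then (1 : ℝ) else 0)) (by simp) ?_ (-(t / 2))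
  · refine le_trans (le_of_eq ?_) (key.trans (Real.exp_le_exp.mpr ?_))
    · congr 1
      ext ω
      simp only [Set.mem_ofPred_eq, strongPairs]
      have : (∑ i, ∑ j, if ω.1.Adj i j then
          -(1 / 2) * (if i ∈ A ∧ j ∈ B ∧ θ ≤ winRate ω.2 i j then (1 : ℝ) else 0) else 0) =
          -(1 / 2) * ∑ i, ∑ j, if ω.1.Adj i j then
            (if i ∈ A ∧ j ∈ B ∧ θ ≤ winRate ω.2 i j then (1 : ℝ) else 0) else 0 := by
        simp_rw [Finset.mul_sum, mul_ite, mul_zero]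
      rw [this]
      constructor <;> intro h <;> linarith
    · simp_rw [← Finset.mul_sum]
      have := mul_le_mul_of_nonneg_left (card_mul_card_sub_le A B)
        (show 0 ≤ (p : ℝ) * ρ / 4 by positivity)
      linarith
  · intro q
    obtain ⟨h1, h2⟩ := hbal q
    have e1 := hprob q _ (q.1.1 ∈ A) (q.1.2 ∈ B) h1
    have e2 := hprob q _ (q.1.2 ∈ A) (q.1.1 ∈ B) h2
    calc _ ≤ ∫ z, (1 - (1 / 4) * ((if q.1.1 ∈ A ∧ q.1.2 ∈ B ∧ θ ≤ successRate z then (1 : ℝ) else 0)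
          + (if q.1.2 ∈ A ∧ q.1.1 ∈ B ∧ θ ≤ 1 - successRate z then (1 : ℝ) else 0)))
            ∂(pairLaw L w q) := by
          refine integral_mono Integrable.of_finite Integrable.of_finite fun z => ?_
          dsimp only
          have ha := hexp (q.1.1 ∈ A ∧ q.1.2 ∈ B ∧ θ ≤ successRate z)
          have hb := hexp (q.1.2 ∈ A ∧ q.1.1 ∈ B ∧ θ ≤ 1 - successRate z)
          generalize (if q.1.1 ∈ A ∧ q.1.2 ∈ B ∧ θ ≤ successRate z then (1 : ℝ) else 0) = a at *
          generalize (if q.1.2 ∈ A ∧ q.1.1 ∈ B ∧ θ ≤ 1 - successRate z then (1 : ℝ) else 0) = b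
            at *
          -- Convexity bounds `exp (-(a + b) / 2)` by the mean of `exp (-a)` and `exp (-b)`, and
          -- each of these is linear in its indicator by `hexp`. No joint law of `a` and `b` is
          -- needed.
          have hconv := convexOn_exp.2 (Set.mem_univ (-a)) (Set.mem_univ (-b))
            (show (0 : ℝ) ≤ 1 / 2 by norm_num) (show (0 : ℝ) ≤ 1 / 2 by norm_num) (by norm_num)
          simp only [smul_eq_mul] at hconv
          rw [show -(1 / 2) * a + -(1 / 2) * b = 1 / 2 * -a + 1 / 2 * -b by ring]
          linarith
      _ ≤ _ := by
          rw [integral_sub Integrable.of_finite Integrable.of_finite, integral_const_mul,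
            integral_add Integrable.of_finite Integrable.of_finite, integral_const]
          simp only [probReal_univ, one_smul, ne_eq, q.2.ne, q.2.ne', not_false_eq_true, true_and]
          have r1 : ∀ (P : Prop) [Decidable P], (if P then ρ else 0) = ρ * (if P then (1 : ℝ) else 0) := by
            intro P _; split_ifs <;> simp
          rw [r1] at e1 e2
          linarith

theorem sum_sum_offDiag_row {n : ℕ} (i : Fin n) {c : ℝ} (hc : 0 ≤ c) :
    ∑ a, ∑ j, (if a ≠ j ∧ a = i then c else 0) ≤ n * c := by
  rw [Finset.sum_eq_single i (fun a _ ha => by simp [ha]) (by simp)]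
  calc _ ≤ ∑ _j : Fin n, c := Finset.sum_le_sum fun j _ => by split_ifs <;> simp [hc]
    _ = n * c := by simp

open Classical in
/-- A vertex of the binomial random graph with `n` vertices has degree at least `4 n p` with
probability at most `exp (-2 n p)`. -/
theorem measure_degree_ge_le {n L : ℕ} (p : unitInterval) (w : Fin n → ℝ) (i : Fin n) :
    (observationLaw L p w).real
        {ω | 4 * (n * (p : ℝ)) ≤ ∑ j, if ω.1.Adj i j then (1 : ℝ) else 0} ≤
      Real.exp (-(2 * (n * (p : ℝ)))) := by
  have hp0 : (0 : ℝ) ≤ p := p.2.1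
  have he : Real.exp 1 ≤ 3 := by linarith [Real.exp_one_lt_d9]
  -- With tilt `1`, an edge at `i` contributes `e - 1 ≤ 2`, which gives the exponent `2 n p - 4 n
  -- p`.
  have key := measure_sum_adj_ge_le (L := L) p w (fun a _ _ => if a = i then (1 : ℝ) else 0)
    (fun a j => if a ≠ j ∧ a = i then (2 : ℝ) else 0) (by simp) ?_ (4 * (n * (p : ℝ)))
  · refine le_trans (le_of_eq ?_) (key.trans (Real.exp_le_exp.mpr ?_))
    · congr 1
      ext ω
      simp only [Set.mem_ofPred_eq]
      have hrow : (∑ a, ∑ j, if ω.1.Adj a j then (if a = i then (1 : ℝ) else 0) else 0) =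
          ∑ j, if ω.1.Adj i j then (1 : ℝ) else 0 := by
        rw [Finset.sum_eq_single i (fun a _ ha => by simp [ha]) (by simp)]
        simp only [if_true]
      rw [hrow]
    · have := mul_le_mul_of_nonneg_left (sum_sum_offDiag_row i (show (0 : ℝ) ≤ 2 by norm_num)) hp0
      linarith
  · intro q
    simp only [integral_const, probReal_univ, one_smul, ne_eq, q.2.ne, q.2.ne', not_false_eq_true,
      true_and]
    by_cases h1 : q.1.1 = i
    · have h2 : q.1.2 ≠ i := fun h => q.2.ne (h1.trans h.symm)
      simp only [h1, h2, if_true, if_false, add_zero]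
      linarith
    · by_cases h2 : q.1.2 = i
      · simp only [h1, h2, if_true, if_false, zero_add]
        linarith
      · simp [h1, h2]

open Classical in
/-- The violation of the balance equation at `i` by the scores `w`. -/
def balanceError {n L : ℕ} (w : Fin n → ℝ) (G : SimpleGraph (Fin n)) (y : Comparisons n L)
    (i : Fin n) : ℝ :=
  ∑ j, if G.Adj i j then (w i + w j) * (winRate y i j - w i / (w i + w j)) else 0

/-- Each term is a centred win rate times `w i + w j ≤ 2 * wmax`, so Hoeffding's lemma applies edge
by edge. The bound on `s` keeps every exponent below `1`, where `exp x ≤ 1 + 2 x`. Both signs of `s`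
are allowed, for the two tails. -/
theorem measure_balanceError_ge_le {n L : ℕ} (hL : 1 ≤ L) (p : unitInterval) {w : Fin n → ℝ}
    {wmax : ℝ} (hw : ∀ i, 0 < w i) (hmax : ∀ i, w i ≤ wmax) (i : Fin n) {s : ℝ}
    (hs : s ^ 2 * wmax ^ 2 ≤ 2 * L) (t : ℝ) :
    (observationLaw L p w).real {ω | t ≤ s * balanceError w ω.1 ω.2 i} ≤
      Real.exp (p * (n * (s ^ 2 * wmax ^ 2 / L)) - t) := by
  classical
  have hp0 : (0 : ℝ) ≤ p := p.2.1
  have hL0 : (0 : ℝ) < L := by exact_mod_cast hL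
  have hmgf : ∀ (q : Pair n) (a : ℝ), a ^ 2 = s ^ 2 * (w q.1.1 + w q.1.2) ^ 2 →
      ∫ z, Real.exp (a * (successRate z - btlProb w q.1.1 q.1.2)) ∂(pairLaw L w q) ≤
        1 + s ^ 2 * wmax ^ 2 / L := by
    intro q a ha
    have hsum : (w q.1.1 + w q.1.2) ^ 2 ≤ (2 * wmax) ^ 2 :=
      pow_le_pow_left₀ (by linarith [hw q.1.1, hw q.1.2])
        (by linarith [hmax q.1.1, hmax q.1.2]) 2
    have ha' : a ^ 2 ≤ 4 * (s ^ 2 * wmax ^ 2) := by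
      rw [ha]
      calc s ^ 2 * (w q.1.1 + w q.1.2) ^ 2 ≤ s ^ 2 * (2 * wmax) ^ 2 :=
            mul_le_mul_of_nonneg_left hsum (sq_nonneg s)
        _ = _ := by ring
    refine (integral_exp_successRate_le hL _ a).trans ?_
    set x := a ^ 2 / (8 * L) with hx
    have hx0 : 0 ≤ x := by positivity
    have hx1 : x ≤ s ^ 2 * wmax ^ 2 / L / 2 := by
      rw [hx, div_div, div_le_div_iff₀ (by positivity) (by positivity)]
      nlinarith
    have hx2 : s ^ 2 * wmax ^ 2 / L / 2 ≤ 1 := by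
      rw [div_div, div_le_one (by positivity)]
      linarith
    have habs : |x| ≤ 1 := by rw [abs_of_nonneg hx0]; linarith
    have := Real.abs_exp_sub_one_le habs
    rw [abs_of_nonneg hx0] at this
    linarith [le_abs_self (Real.exp x - 1)]
  have key := measure_sum_adj_ge_le (L := L) p w
    (fun a j x => if a = i then s * ((w a + w j) * (x - w a / (w a + w j))) else 0)
    (fun a j => if a ≠ j ∧ a = i then s ^ 2 * wmax ^ 2 / L else 0) (by simp) ?_ t
  · refine le_trans (le_of_eq ?_) (key.trans (Real.exp_le_exp.mpr ?_))
    · congr 1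
      ext ω
      simp only [Set.mem_ofPred_eq]
      rw [Finset.sum_eq_single i (fun a _ ha => by simp [ha]) (by simp)]
      simp only [if_true, balanceError, Finset.mul_sum, mul_ite, mul_zero]
    · have := mul_le_mul_of_nonneg_left (sum_sum_offDiag_row i
        (show (0 : ℝ) ≤ s ^ 2 * wmax ^ 2 / L by positivity)) hp0
      linarith
  · intro q
    simp only [ne_eq, q.2.ne, q.2.ne', not_false_eq_true, true_and]
    have hb := coe_btlProb hw q.1.1 q.1.2
    have hpos : w q.1.1 + w q.1.2 ≠ 0 := by linarith [hw q.1.1, hw q.1.2]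
    by_cases h1 : q.1.1 = i
    · have h2 : q.1.2 ≠ i := fun h => q.2.ne (h1.trans h.symm)
      simp only [h1, h2, if_true, if_false, add_zero]
      have := hmgf q (s * (w q.1.1 + w q.1.2)) (by ring)
      rw [hb, h1] at this
      simpa only [mul_assoc] using this
    · by_cases h2 : q.1.2 = i
      · simp only [h1, h2, if_true, if_false, zero_add]
        have := hmgf q (-(s * (w q.1.1 + w q.1.2))) (by ring)
        refine le_trans (le_of_eq ?_) this
        congr 1
        ext z
        congr 1
        rw [hb, ← h2]
        have hpos' : w q.1.2 + w q.1.1 ≠ 0 := by rwa [add_comm]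
        field_simp
        ring
      · simp [h1, h2]

/-! ### Stationary vectors of column-stochastic matrices -/

section Stochastic

variable {ι : Type*} [Fintype ι] {P : Matrix ι ι ℝ}

/-- The entrywise absolute value of a fixed vector of a column-stochastic matrix is fixed. -/
theorem mulVec_abs_eq_of_mulVec_eq (hP : ∀ i j, 0 ≤ P i j) (hcol : ∀ j, ∑ i, P i j = 1)
    {v : ι → ℝ} (hv : P.mulVec v = v) : P.mulVec (fun i => |v i|) = fun i => |v i| := by
  have hle : ∀ i ∈ Finset.univ, |v i| ≤ P.mulVec (fun j => |v j|) i := by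
    intro i _
    conv_lhs => rw [← hv]
    simp only [Matrix.mulVec, dotProduct]
    refine (Finset.abs_sum_le_sum_abs _ _).trans (Finset.sum_le_sum fun j _ => ?_)
    rw [abs_mul, abs_of_nonneg (hP i j)]
  have hsum : ∑ i, |v i| = ∑ i, P.mulVec (fun j => |v j|) i := by
    simp only [Matrix.mulVec, dotProduct]
    rw [Finset.sum_comm]
    simp_rw [← Finset.sum_mul, hcol, one_mul]
  -- The triangle inequality holds entrywise and both sides have the same total, so every entry is
  -- an equality.
  funext i
  exact ((Finset.sum_eq_sum_iff_of_le hle).mp hsum i (Finset.mem_univ i)).symm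

/-- The all-ones vector is a left fixed vector, so `P - 1` is singular and has a right null vector.
Its absolute value, normalised, is stationary. -/
theorem exists_mem_stdSimplex_mulVec_eq [Nonempty ι] (hP : ∀ i j, 0 ≤ P i j)
    (hcol : ∀ j, ∑ i, P i j = 1) : ∃ v ∈ stdSimplex ℝ ι, P.mulVec v = v := by
  classical
  have hleft : ∃ v : ι → ℝ, v ≠ 0 ∧ Matrix.vecMul v (P - 1) = 0 := by
    refine ⟨fun _ => 1, fun h => one_ne_zero (congrFun h (Classical.arbitrary ι)), ?_⟩
    rw [Matrix.vecMul_sub, Matrix.vecMul_one]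
    funext j
    simp [Matrix.vecMul, dotProduct, hcol]
  obtain ⟨v, hv0, hv⟩ := Matrix.exists_mulVec_eq_zero_iff.mpr
    (Matrix.exists_vecMul_eq_zero_iff.mp hleft)
  rw [Matrix.sub_mulVec, Matrix.one_mulVec, sub_eq_zero] at hv
  have hpos : 0 < ∑ i, |v i| := by
    obtain ⟨i, hi⟩ := Function.ne_iff.mp hv0
    exact Finset.sum_pos' (fun _ _ => abs_nonneg _) ⟨i, Finset.mem_univ i, abs_pos.mpr hi⟩
  refine ⟨(∑ i, |v i|)⁻¹ • fun i => |v i|, ⟨fun i => ?_, ?_⟩, ?_⟩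
  · simp only [Pi.smul_apply, smul_eq_mul]
    positivity
  · simp only [Pi.smul_apply, smul_eq_mul, ← Finset.mul_sum]
    exact inv_mul_cancel₀ hpos.ne'
  · rw [Matrix.mulVec_smul, mulVec_abs_eq_of_mulVec_eq hP hcol hv]

/-- If the nonzero nonnegative fixed vectors of a column-stochastic matrix are positive, then its
stationary distribution is unique. -/
theorem eq_of_mulVec_eq_of_pos [Nonempty ι] (hP : ∀ i j, 0 ≤ P i j) (hcol : ∀ j, ∑ i, P i j = 1)
    (hpos : ∀ u : ι → ℝ, (∀ i, 0 ≤ u i) → u ≠ 0 → P.mulVec u = u → ∀ i, 0 < u i)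
    {v v' : ι → ℝ} (hv : v ∈ stdSimplex ℝ ι) (hv' : v' ∈ stdSimplex ℝ ι)
    (hPv : P.mulVec v = v) (hPv' : P.mulVec v' = v') : v = v' := by
  set d := v - v' with hd
  have hPd : P.mulVec d = d := by rw [hd, Matrix.mulVec_sub, hPv, hPv']
  have hsum : ∑ i, d i = 0 := by
    simp only [hd, Pi.sub_apply, Finset.sum_sub_distrib, hv.2, hv'.2, sub_self]
  have habs := mulVec_abs_eq_of_mulVec_eq hP hcol hPd
  set a : ι → ℝ := fun i => |d i| with ha
  -- Twice the positive part of `d` is fixed. Were it nonzero, it would be positive everywhere, and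
  -- so would `d`, whose entries sum to zero.
  have hplus : a + d = 0 := by
    by_contra hne
    have h := hpos (a + d) (fun i => by
      simp only [ha, Pi.add_apply]
      linarith [neg_abs_le (d i)])
      hne (by rw [Matrix.mulVec_add, habs, hPd])
    have hdpos : ∀ i, 0 < d i := by
      intro i
      have hi := h i
      simp only [ha, Pi.add_apply] at hi
      by_contra hneg
      rw [abs_of_nonpos (not_lt.mp hneg)] at hi
      linarith
    exact absurd hsum (Finset.sum_pos (fun i _ => hdpos i) Finset.univ_nonempty).ne'
  have hle : ∀ i ∈ Finset.univ, d i ≤ 0 := by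
    intro i _
    have := congrFun hplus i
    simp only [ha, Pi.add_apply, Pi.zero_apply] at this
    linarith [abs_nonneg (d i)]
  have hzero := (Finset.sum_eq_zero_iff_of_nonpos hle).mp hsum
  funext i
  have := hzero i (Finset.mem_univ i)
  simp only [hd, Pi.sub_apply] at this
  linarith

end Stochastic

/-! ### Balance equations of Rank Centrality -/

section RankCentrality

variable {n L : ℕ}

theorem winRate_mem_Icc (y : Comparisons n L) (i j : Fin n) : winRate y i j ∈ Set.Icc (0 : ℝ) 1 := by
  rcases lt_trichotomy i j with h | rfl | h
  · rw [show winRate y i j = _ from winRate_fst_snd y ⟨(i, j), h⟩]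
    exact successRate_mem_Icc _
  · simp [winRate]
  · rw [show winRate y i j = _ from winRate_snd_fst y ⟨(j, i), h⟩]
    have := successRate_mem_Icc (y ⟨(j, i), h⟩)
    exact ⟨by linarith [this.2], by linarith [this.1]⟩

theorem winRate_add_swap (y : Comparisons n L) {i j : Fin n} (hij : i ≠ j) :
    winRate y i j + winRate y j i = 1 := by
  rcases lt_or_gt_of_ne hij with h | h
  · rw [show winRate y i j = _ from winRate_fst_snd y ⟨(i, j), h⟩,
      show winRate y j i = _ from winRate_snd_fst y ⟨(i, j), h⟩]
    ring
  · rw [show winRate y i j = _ from winRate_snd_fst y ⟨(j, i), h⟩,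
      show winRate y j i = _ from winRate_fst_snd y ⟨(j, i), h⟩]
    ring

open Classical in
/-- The total win rate of the neighbours of `i` against `i`. -/
def lossSum (G : SimpleGraph (Fin n)) (y : Comparisons n L) (i : Fin n) : ℝ :=
  ∑ k, if G.Adj i k then winRate y k i else 0

open Classical in
theorem lossSum_nonneg (G : SimpleGraph (Fin n)) (y : Comparisons n L) (i : Fin n) :
    0 ≤ lossSum G y i :=
  Finset.sum_nonneg fun k _ => by split_ifs; exacts [(winRate_mem_Icc y k i).1, le_rfl]

open Classical in
theorem lossSum_le (G : SimpleGraph (Fin n)) (y : Comparisons n L) (i : Fin n) :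
    lossSum G y i ≤ ∑ k, if G.Adj i k then (1 : ℝ) else 0 :=
  Finset.sum_le_sum fun k _ => by split_ifs; exacts [(winRate_mem_Icc y k i).2, le_rfl]

open Classical in
theorem transitionMatrix_apply (G : SimpleGraph (Fin n)) (y : Comparisons n L) (i j : Fin n) :
    transitionMatrix G y i j = (if i = j then 1 - 1 / (G.maxDegree : ℝ) * lossSum G y j else 0) +
      1 / (G.maxDegree : ℝ) * (if G.Adj i j then winRate y i j else 0) := by
  simp only [transitionMatrix, Matrix.of_apply, lossSum]
  by_cases hij : i = j
  · subst hij
    simp only [if_true, SimpleGraph.irrefl, if_false, mul_zero, add_zero, Finset.sum_filter,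
      G.adj_comm]
  · simp only [hij, if_false, zero_add, mul_ite, mul_zero]

theorem sum_transitionMatrix (G : SimpleGraph (Fin n)) (y : Comparisons n L) (j : Fin n) :
    ∑ i, transitionMatrix G y i j = 1 := by
  classical
  simp_rw [transitionMatrix_apply]
  rw [Finset.sum_add_distrib, Finset.sum_ite_eq' Finset.univ j, ← Finset.mul_sum]
  simp [lossSum, G.adj_comm]

theorem transitionMatrix_nonneg (G : SimpleGraph (Fin n)) (y : Comparisons n L) (i j : Fin n) :
    0 ≤ transitionMatrix G y i j := by
  classical
  rw [transitionMatrix_apply]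
  have hdeg : lossSum G y j ≤ G.maxDegree := by
    refine (lossSum_le G y j).trans ?_
    rw [← Finset.sum_filter, Finset.sum_const, nsmul_eq_mul, mul_one]
    have := G.degree_le_maxDegree j
    rw [← SimpleGraph.card_neighborFinset_eq_degree, SimpleGraph.neighborFinset_eq_filter] at this
    exact_mod_cast this
  have h1 : 1 / (G.maxDegree : ℝ) * lossSum G y j ≤ 1 := by
    rw [one_div_mul_eq_div]
    exact div_le_one_of_le₀ hdeg (Nat.cast_nonneg _)
  refine add_nonneg ?_ (mul_nonneg (by positivity) ?_)
  · split_ifs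
    · linarith
    · exact le_rfl
  · split_ifs
    · exact (winRate_mem_Icc y i j).1
    · exact le_rfl

open Classical in
/-- The balance equations satisfied by a stationary vector of Rank Centrality. -/
theorem sum_winRate_mul_eq (G : SimpleGraph (Fin n)) (y : Comparisons n L)
    (hd : 0 < G.maxDegree) {u : Fin n → ℝ} (hu : (transitionMatrix G y).mulVec u = u) (i : Fin n) :
    ∑ k, (if G.Adj i k then winRate y i k * u k else 0) = lossSum G y i * u i := by
  have hd' : (0 : ℝ) < G.maxDegree := by exact_mod_cast hd
  have h := congrFun hu i
  simp only [Matrix.mulVec, dotProduct, transitionMatrix_apply, add_mul, ite_mul, zero_mul] at h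
  rw [Finset.sum_add_distrib, Finset.sum_ite_eq Finset.univ i] at h
  simp only [Finset.mem_univ, if_true, mul_assoc, ← Finset.mul_sum, ite_mul, zero_mul] at h
  field_simp at h
  linarith

/-! ### Deterministic stability of the stationary vector -/

/-- The deterministic regularity of the observations under which Rank Centrality is analysed: `N`
is the order of magnitude of the degrees, `θ` a threshold for win rates, `τ` a bound on the
violation of the balance equations by the scores. -/
structure RegularObservation (w : Fin n → ℝ) (N θ ρ τ : ℝ) (G : SimpleGraph (Fin n))
    (y : Comparisons n L) : Prop where
  loss_le : ∀ i, lossSum G y i ≤ 4 * N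
  error_le : ∀ i, |balanceError w G y i| ≤ τ
  row : ∀ i, ρ * N / 8 ≤ strongPairs θ G y {i} Finset.univ
  expansion : ∀ A B : Finset (Fin n), ρ * N / 8 ≤ A.card → (n : ℝ) / 2 ≤ B.card →
    A.card * N * ρ / 16 ≤ strongPairs θ G y A B

/-- Since `y_ik + y_ki = 1`, the centred sum is exactly inflow minus outflow when the scores are put
into the balance equations. -/
theorem balanceError_eq {w : Fin n → ℝ} (hw : ∀ i, 0 < w i) (G : SimpleGraph (Fin n))
    (y : Comparisons n L) (i : Fin n) [DecidableRel G.Adj] :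
    balanceError w G y i =
      (∑ k, if G.Adj i k then winRate y i k * w k else 0) - w i * lossSum G y i := by
  classical
  rw [balanceError, lossSum, Finset.mul_sum, ← Finset.sum_sub_distrib]
  refine Finset.sum_congr rfl fun k _ => ?_
  by_cases h : G.Adj i k
  · simp only [h, if_true]
    have h1 := winRate_add_swap y h.ne
    have h2 : winRate y k i = 1 - winRate y i k := by linarith
    have h3 : w i + w k ≠ 0 := by linarith [hw i, hw k]
    rw [h2]
    field_simp
    ring
  · simp [h]

open Classical in
/-- A nonnegative function that vanishes somewhere and is almost superharmonic is small
on every large set. -/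
theorem RegularObservation.lower_bound_le {w : Fin n → ℝ} {N θ ρ τ : ℝ} {G : SimpleGraph (Fin n)}
    {y : Comparisons n L} (H : RegularObservation w N θ ρ τ G y) {wmin wmax b : ℝ}
    (hwmin : 0 < wmin) (hw : ∀ i, w i ∈ Set.Icc wmin wmax) (hwb : wmax ≤ b * wmin) (hb : 1 ≤ b)
    (hN : 0 < N) (hθ : 0 < θ) (hθ1 : θ ≤ 1) (hρ : 0 < ρ) (hρ1 : ρ ≤ 1)
    {g : Fin n → ℝ} (hg : ∀ i, 0 ≤ g i) {i₀ : Fin n} (hi₀ : g i₀ = 0) {T : ℝ}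
    (hT : ∀ i, ∑ k, (if G.Adj i k then winRate y i k * (w k * g k) else 0) ≤
      w i * lossSum G y i * g i + T)
    {B : Finset (Fin n)} (hB : (n : ℝ) / 2 ≤ B.card) {h : ℝ} (hh : 0 ≤ h) (hgB : ∀ l ∈ B, h ≤ g l) :
    h * (θ ^ 2 * ρ ^ 2 * wmin * N) ≤ 528 * b * T := by
  have hw0 : ∀ i, 0 < w i := fun i => hwmin.trans_le (hw i).1
  -- The first step of the walk from the zero of `g`: strong neighbours, at least `ρ N / 8` of them
  -- by `H.row`.
  set A : Finset (Fin n) := Finset.univ.filter fun k => G.Adj i₀ k ∧ θ ≤ winRate y i₀ k with hA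
  have hAcard : ρ * N / 8 ≤ A.card := by
    refine (H.row i₀).trans (le_of_eq ?_)
    rw [strongPairs, Finset.sum_eq_single i₀ (fun a _ ha => by simp [ha]) (by simp), hA,
      Finset.card_filter]
    push_cast
    refine Finset.sum_congr rfl fun k _ => ?_
    by_cases h1 : G.Adj i₀ k <;> simp [h1]
  have hApos : (0 : ℝ) < A.card := lt_of_lt_of_le (by positivity) hAcard
  have hterm : ∀ i k, 0 ≤ winRate y i k * (w k * g k) := fun i k =>
    mul_nonneg (winRate_mem_Icc y i k).1 (mul_nonneg (hw0 k).le (hg k))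
  have hsumA : θ * wmin * ∑ k ∈ A, g k ≤ T := by
    have h1 := hT i₀
    rw [hi₀, mul_zero, zero_add] at h1
    refine le_trans ?_ h1
    rw [Finset.mul_sum, hA, Finset.sum_filter]
    refine Finset.sum_le_sum fun k _ => ?_
    by_cases h2 : G.Adj i₀ k
    · by_cases h3 : θ ≤ winRate y i₀ k
      · simp only [h2, h3, and_self, if_true]
        rw [mul_assoc]
        exact mul_le_mul h3 (mul_le_mul_of_nonneg_right (hw k).1 (hg k))
          (mul_nonneg hwmin.le (hg k)) (hθ.le.trans h3)
      · simpa only [h2, h3, and_false, if_true, if_false] using hterm i₀ k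
    · simp [h2]
  have hT0 : 0 ≤ T := le_trans (mul_nonneg (by positivity) (Finset.sum_nonneg fun k _ => hg k)) hsumA
  -- The second step: only strong edges from `A` into `B` are kept, where `g` is at least `h`.
  have hlow : θ * wmin * h * strongPairs θ G y A B ≤
      ∑ i ∈ A, ∑ k, (if G.Adj i k then winRate y i k * (w k * g k) else 0) := by
    rw [strongPairs, Finset.mul_sum, ← Finset.sum_filter_add_sum_filter_not Finset.univ (· ∈ A)]
    have hz : ∑ i with i ∉ A, θ * wmin * h * (∑ j, if G.Adj i j then
        (if i ∈ A ∧ j ∈ B ∧ θ ≤ winRate y i j then (1 : ℝ) else 0) else 0) = 0 := by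
      refine Finset.sum_eq_zero fun i hi => ?_
      simp [(Finset.mem_filter.mp hi).2]
    rw [hz, add_zero, Finset.filter_mem_eq_inter, Finset.univ_inter]
    refine Finset.sum_le_sum fun i _ => ?_
    rw [Finset.mul_sum]
    refine Finset.sum_le_sum fun k _ => ?_
    by_cases h2 : G.Adj i k
    · simp only [h2, if_true]
      split_ifs with h3
      · obtain ⟨_, h4, h5⟩ := h3
        rw [mul_one, mul_assoc]
        exact mul_le_mul h5 (mul_le_mul (hw k).1 (hgB k h4) hh (hw0 k).le)
          (mul_nonneg hwmin.le hh) (hθ.le.trans h5)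
      · rw [mul_zero]
        exact hterm i k
    · simp [h2]
  have hup : ∑ i ∈ A, ∑ k, (if G.Adj i k then winRate y i k * (w k * g k) else 0) ≤
      4 * N * (b * wmin) * ∑ i ∈ A, g i + A.card * T := by
    calc _ ≤ ∑ i ∈ A, (4 * N * (b * wmin) * g i + T) := by
          refine Finset.sum_le_sum fun i _ => (hT i).trans ?_
          have h1 : w i * lossSum G y i ≤ (b * wmin) * (4 * N) :=
            mul_le_mul ((hw i).2.trans hwb) (H.loss_le i) (lossSum_nonneg G y i) (by positivity)
          have := mul_le_mul_of_nonneg_right h1 (hg i)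
          linarith
      _ = _ := by rw [Finset.sum_add_distrib, ← Finset.mul_sum, Finset.sum_const, nsmul_eq_mul]
  have hexp := H.expansion A B hAcard hB
  have h1 : θ * wmin * h * (A.card * N * ρ / 16) ≤
      4 * N * (b * wmin) * ∑ i ∈ A, g i + A.card * T :=
    (mul_le_mul_of_nonneg_left hexp (by positivity)).trans (hlow.trans hup)
  have h2 : 4 * N * (b * wmin) * ∑ i ∈ A, g i * (θ * ρ) ≤ 32 * A.card * b * T := by
    rw [← Finset.sum_mul]
    have e1 : 4 * N * ρ * b * (θ * wmin * ∑ k ∈ A, g k) ≤ 4 * N * ρ * b * T :=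
      mul_le_mul_of_nonneg_left hsumA (by positivity)
    have e2 : N * ρ * (b * T) ≤ 8 * A.card * (b * T) :=
      mul_le_mul_of_nonneg_right (by linarith) (by positivity)
    linarith
  have h3 : A.card * T * (θ * ρ) ≤ A.card * b * T := by
    have e1 : θ * ρ ≤ b := (mul_le_one₀ hθ1 hρ.le hρ1).trans hb
    have := mul_le_mul_of_nonneg_left e1 (show 0 ≤ A.card * T by positivity)
    linarith
  -- After multiplication by `θ * ρ`, `h2` and `h3` bound the right side by `33 * A.card * b * T`;
  -- clearing the denominator `16` gives `528`.
  have h4 := mul_le_mul_of_nonneg_right h1 (show 0 ≤ θ * ρ by positivity)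
  rw [← Finset.sum_mul] at h2
  refine le_of_mul_le_mul_left ?_ hApos
  linarith

open Classical in
/-- Up to the factor `1 - δ`, stationary vectors of Rank Centrality are proportional to the
scores. -/
theorem RegularObservation.exists_approx {w : Fin n → ℝ} {N θ ρ τ : ℝ} {G : SimpleGraph (Fin n)}
    {y : Comparisons n L} (H : RegularObservation w N θ ρ τ G y) {wmin wmax b δ : ℝ}
    (hwmin : 0 < wmin) (hw : ∀ i, w i ∈ Set.Icc wmin wmax) (hwb : wmax ≤ b * wmin) (hb : 1 ≤ b)
    (hN : 0 < N) (hθ : 0 < θ) (hθ1 : θ ≤ 1) (hρ : 0 < ρ) (hρ1 : ρ ≤ 1) [Nonempty (Fin n)]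
    (hδ : 1056 * b * τ ≤ δ * (θ ^ 2 * ρ ^ 2 * wmin * N))
    {u : Fin n → ℝ} (hu0 : ∀ i, 0 ≤ u i)
    (hu : ∀ i, ∑ k, (if G.Adj i k then winRate y i k * u k else 0) = lossSum G y i * u i) :
    ∃ M, 0 ≤ M ∧ (∀ i, u i ≤ M * w i) ∧ ∀ i, (1 - δ) * M * w i ≤ u i := by
  have hw0 : ∀ i, 0 < w i := fun i => hwmin.trans_le (hw i).1
  set r : Fin n → ℝ := fun i => u i / w i with hr
  have hr0 : ∀ i, 0 ≤ r i := fun i => div_nonneg (hu0 i) (hw0 i).le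
  have hur : ∀ i, u i = w i * r i := fun i => by
    simp only [hr]
    field_simp [(hw0 i).ne']
  obtain ⟨i₁, hi₁⟩ := Finite.exists_max r
  obtain ⟨i₂, hi₂⟩ := Finite.exists_min r
  set M := r i₁ with hM
  set m := r i₂ with hm
  have hm0 : 0 ≤ m := hr0 i₂
  have hmM : m ≤ M := hi₂ i₁
  have hτ : 0 ≤ τ := (abs_nonneg _).trans (H.error_le i₁)
  -- Constants fail the balance equations by `balanceError` and `r` satisfies them exactly, so
  -- affine functions of `r` have error `c * balanceError`.
  have hlin : ∀ (i : Fin n) (c d : ℝ),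
      ∑ k, (if G.Adj i k then winRate y i k * (w k * (c + d * r k)) else 0) =
        w i * lossSum G y i * (c + d * r i) + c * balanceError w G y i := by
    intro i c d
    have h1 : ∑ k, (if G.Adj i k then winRate y i k * (w k * (c + d * r k)) else 0) =
        c * (∑ k, if G.Adj i k then winRate y i k * w k else 0) +
          d * ∑ k, (if G.Adj i k then winRate y i k * u k else 0) := by
      rw [Finset.mul_sum, Finset.mul_sum, ← Finset.sum_add_distrib]
      refine Finset.sum_congr rfl fun k _ => ?_
      split_ifs
      · rw [hur k]
        ring
      · simp
    rw [h1, hu i, balanceError_eq hw0, hur i]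
    ring
  have hgap : (M - m) / 2 * (θ ^ 2 * ρ ^ 2 * wmin * N) ≤ 528 * b * (M * τ) := by
    set B₁ := Finset.univ.filter fun l => r l ≤ (M + m) / 2 with hB₁
    set B₂ := Finset.univ.filter fun l => (M + m) / 2 ≤ r l with hB₂
    have hcover : n ≤ B₁.card + B₂.card := by
      have : (Finset.univ : Finset (Fin n)) ⊆ B₁ ∪ B₂ := by
        intro l _
        simpa [hB₁, hB₂] using le_total (r l) ((M + m) / 2)
      simpa using (Finset.card_le_card this).trans (Finset.card_union_le _ _)
    have hcover' : (n : ℝ) ≤ B₁.card + B₂.card := by exact_mod_cast hcover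
    -- If many ratios lie below the midpoint, `M - r` is large on them and vanishes at the
    -- maximiser; otherwise `r - m` is used from the minimiser. The error is at most `M * τ` in both
    -- cases, as `m ≤ M`.
    rcases le_total ((n : ℝ) / 2) B₁.card with hB | hB
    · refine H.lower_bound_le hwmin hw hwb hb hN hθ hθ1 hρ hρ1 (g := fun i => M + (-1) * r i)
        (fun i => by linarith [hi₁ i]) (i₀ := i₁) (by simp [hM]) (fun i => ?_) hB (by linarith) ?_
      · rw [hlin i M (-1)]
        have := mul_le_mul_of_nonneg_left ((le_abs_self _).trans (H.error_le i)) (hm0.trans hmM)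
        linarith
      · intro l hl
        have := (Finset.mem_filter.mp hl).2
        linarith
    · have hB' : (n : ℝ) / 2 ≤ B₂.card := by linarith
      refine H.lower_bound_le hwmin hw hwb hb hN hθ hθ1 hρ hρ1 (g := fun i => -m + 1 * r i)
        (fun i => by linarith [hi₂ i]) (i₀ := i₂) (by simp [hm]) (fun i => ?_) hB' (by linarith) ?_
      · rw [hlin i (-m) 1]
        have h1 := mul_le_mul_of_nonneg_left ((neg_le_abs _).trans (H.error_le i)) hm0
        have h2 := mul_le_mul_of_nonneg_right hmM hτ
        linarith
      · intro l hl
        have := (Finset.mem_filter.mp hl).2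
        linarith
  have hgap' : M - m ≤ δ * M := by
    have hpos : 0 < θ ^ 2 * ρ ^ 2 * wmin * N := by positivity
    have := mul_le_mul_of_nonneg_left hδ (hm0.trans hmM)
    refine le_of_mul_le_mul_right ?_ hpos
    linarith
  refine ⟨M, hm0.trans hmM, fun i => ?_, fun i => ?_⟩
  · rw [hur i, mul_comm]
    exact mul_le_mul_of_nonneg_right (hi₁ i) (hw0 i).le
  · rw [hur i, mul_comm (w i)]
    exact mul_le_mul_of_nonneg_right (by linarith [hi₂ i]) (hw0 i).le

theorem RegularObservation.maxDegree_pos {w : Fin n → ℝ} {N θ ρ τ : ℝ} {G : SimpleGraph (Fin n)}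
    {y : Comparisons n L} (H : RegularObservation w N θ ρ τ G y) (hN : 0 < N) (hρ : 0 < ρ)
    [DecidableRel G.Adj] (i : Fin n) : 0 < G.maxDegree := by
  by_contra hd
  have hnadj : ∀ k l, ¬ G.Adj k l := by
    intro k l hkl
    have h1 := G.degree_le_maxDegree k
    have h2 : 0 < G.degree k := (G.degree_pos_iff_exists_adj k).mpr ⟨l, hkl⟩
    omega
  have h := H.row i
  have : 0 < ρ * N / 8 := by positivity
  simp only [strongPairs, hnadj, if_false, Finset.sum_const_zero] at h
  linarith

/-- The two-sided comparison with `M * w` has relative error `δ` on the lower side only, so a gap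
`w_K - w_{K+1} > δ * wmax` suffices to separate the two groups. It also makes every nonzero
nonnegative fixed vector positive, which yields uniqueness. -/
theorem RegularObservation.recovers {w : Fin n → ℝ} {N θ ρ τ : ℝ} {G : SimpleGraph (Fin n)}
    {y : Comparisons n L} (H : RegularObservation w N θ ρ τ G y) {wmin wmax b δ : ℝ}
    (hwmin : 0 < wmin) (hw : ∀ i, w i ∈ Set.Icc wmin wmax) (hwb : wmax ≤ b * wmin) (hb : 1 ≤ b)
    (hN : 0 < N) (hθ : 0 < θ) (hθ1 : θ ≤ 1) (hρ : 0 < ρ) (hρ1 : ρ ≤ 1)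
    (hδ : 1056 * b * τ ≤ δ * (θ ^ 2 * ρ ^ 2 * wmin * N)) (hanti : Antitone w)
    {K : ℕ} (hK : 1 ≤ K) (hKn : K < n) (hδ0 : 0 ≤ δ) (hsep : δ < separation w wmax K hKn) :
    RankCentralityRecovers K G y := by
  classical
  have : Nonempty (Fin n) := ⟨⟨K, hKn⟩⟩
  have hd := H.maxDegree_pos hN hρ ⟨K, hKn⟩
  -- Only the decidability instances differ.
  have hd' : 0 < G.maxDegree := by convert hd
  have hw0 : ∀ i, 0 < w i := fun i => hwmin.trans_le (hw i).1
  set wK := w ⟨K - 1, lt_of_le_of_lt (Nat.sub_le K 1) hKn⟩ with hwK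
  set wK' := w ⟨K, hKn⟩ with hwK'
  have hwmax : 0 < wmax := (hw0 ⟨K, hKn⟩).trans_le (hw _).2
  have hstep : wK' < (1 - δ) * wK := by
    rw [separation, lt_div_iff₀ hwmax] at hsep
    have := mul_le_mul_of_nonneg_left (hw ⟨K - 1, lt_of_le_of_lt (Nat.sub_le K 1) hKn⟩).2 hδ0
    linarith
  have hδ1 : 0 < 1 - δ := by
    have h1 : 0 < (1 - δ) * wK := (hw0 _).trans hstep
    exact pos_of_mul_pos_left h1 (hw0 _).le
  have hfix : ∀ u : Fin n → ℝ, (∀ i, 0 ≤ u i) → u ≠ 0 → (transitionMatrix G y).mulVec u = u →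
      (∀ i, 0 < u i) ∧ ∀ i j : Fin n, (i : ℕ) < K → K ≤ (j : ℕ) → u j < u i := by
    intro u hu0 hune hu
    obtain ⟨M, hM0, hup, hlow⟩ := H.exists_approx hwmin hw hwb hb hN hθ hθ1 hρ hρ1 hδ hu0
      (sum_winRate_mul_eq G y hd' hu)
    have hM : 0 < M := by
      refine lt_of_le_of_ne hM0 fun h0 => hune (funext fun i => ?_)
      have := hup i
      rw [← h0, zero_mul] at this
      exact le_antisymm this (hu0 i)
    refine ⟨fun i => lt_of_lt_of_le (mul_pos (mul_pos hδ1 hM) (hw0 i)) (hlow i), ?_⟩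
    intro i j hi hj
    have h1 : wK ≤ w i := hanti (Fin.le_def.mpr (by simp only; omega))
    have h2 : w j ≤ wK' := hanti (Fin.le_def.mpr hj)
    calc u j ≤ M * w j := hup j
      _ ≤ M * wK' := mul_le_mul_of_nonneg_left h2 hM0
      _ < M * ((1 - δ) * wK) := mul_lt_mul_of_pos_left hstep hM
      _ = (1 - δ) * M * wK := by ring
      _ ≤ (1 - δ) * M * w i := mul_le_mul_of_nonneg_left h1 (by positivity)
      _ ≤ u i := hlow i
  obtain ⟨v, hv, hPv⟩ := exists_mem_stdSimplex_mulVec_eq (transitionMatrix_nonneg G y)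
    (sum_transitionMatrix G y)
  refine ⟨v, ⟨hv, hPv⟩, fun v' hv' => ?_, fun S hS => ?_⟩
  · exact eq_of_mulVec_eq_of_pos (transitionMatrix_nonneg G y) (sum_transitionMatrix G y)
      (fun u h0 h1 h2 => (hfix u h0 h1 h2).1) hv'.1 hv hv'.2 hPv
  · have hvne : v ≠ 0 := by
      rintro rfl
      simpa using hv.2
    have hord := (hfix v hv.1 hvne hPv).2
    have hcard : (Finset.univ.filter fun i : Fin n => (i : ℕ) < K).card = K := by
      rw [Fin.card_filter_val_lt, min_eq_right hKn.le]
    by_contra hne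
    obtain ⟨i, hi, hiS⟩ : ∃ i ∈ Finset.univ.filter (fun i : Fin n => (i : ℕ) < K), i ∉ S := by
      by_contra hcon
      push Not at hcon
      exact hne (Finset.eq_of_subset_of_card_le hcon (by rw [hcard, hS.1])).symm
    obtain ⟨j, hjS, hj⟩ : ∃ j ∈ S, j ∉ Finset.univ.filter (fun i : Fin n => (i : ℕ) < K) := by
      by_contra hcon
      push Not at hcon
      exact hne (Finset.eq_of_subset_of_card_le hcon (by rw [hcard, hS.1]))
    simp only [Finset.mem_filter, Finset.mem_univ, true_and, not_lt] at hi hj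
    exact absurd (hS.2 j hjS i hiS) (not_le.mpr (hord i j hi hj))

end RankCentrality

/-! ### Regularity holds with high probability -/

theorem log_natCast_le_sqrt (n : ℕ) : Real.log n ≤ √(n : ℝ) := by
  have h1 : Real.log (√(√(n : ℝ))) ≤ √(√(n : ℝ)) - 1 ∨ n = 0 := by
    rcases Nat.eq_zero_or_pos n with h | h
    · exact Or.inr h
    · have : (0 : ℝ) < n := by exact_mod_cast h
      exact Or.inl (Real.log_le_sub_one_of_pos (by positivity))
  rcases h1 with h1 | rfl
  · rw [Real.log_sqrt (Real.sqrt_nonneg _), Real.log_sqrt (Nat.cast_nonneg _)] at h1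
    have h2 : √(√(n : ℝ)) ^ 2 = √(n : ℝ) := Real.sq_sqrt (Real.sqrt_nonneg _)
    -- With `x = n ^ (1/4)`, `log n ≤ 4 (x - 1) ≤ x ^ 2`.
    nlinarith [sq_nonneg (√(√(n : ℝ)) - 2)]
  · simp

theorem measureReal_exists_le_sum {Ω ι : Type*} [MeasurableSpace Ω] [Fintype ι] (μ : Measure Ω)
    [IsFiniteMeasure μ] (E : ι → Set Ω) {c : ℝ} (hE : ∀ i, μ.real (E i) ≤ c) :
    μ.real {ω | ∃ i, ω ∈ E i} ≤ Fintype.card ι * c := by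
  have : {ω | ∃ i, ω ∈ E i} = ⋃ i, E i := by
    ext
    simp
  rw [this]
  refine (measureReal_iUnion_fintype_le E).trans ?_
  calc ∑ i, μ.real (E i) ≤ ∑ _i : ι, c := Finset.sum_le_sum fun i _ => hE i
    _ = _ := by rw [Finset.sum_const, nsmul_eq_mul, Finset.card_univ]

/-- The observations are regular with probability at least `1 - 4 / n`. -/
theorem measure_not_regularObservation_le {n L : ℕ} (hn : 4 ≤ n) (hL : 1 ≤ L) (p : unitInterval)
    {w : Fin n → ℝ} {wmax θ ρ : ℝ} (hw : ∀ i, 0 < w i) (hmax : ∀ i, w i ≤ wmax) (hwmax : 0 < wmax)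
    (hρ : 0 < ρ) (hρ1 : ρ ≤ 1) (hbal : ∀ q, PairBalanced L w θ ρ q)
    (hdense : 1024 * (n : ℝ) ≤ (ρ * (n * p)) ^ 2) :
    (observationLaw L p w).real {ω | ¬ RegularObservation w (n * (p : ℝ)) θ ρ
      (4 * wmax * √(n * p * Real.log n / L)) ω.1 ω.2} ≤ 4 / n := by
  classical
  set μ := observationLaw L p w with hμ
  set N : ℝ := n * (p : ℝ) with hN
  set τ : ℝ := 4 * wmax * √(N * Real.log n / L) with hτ
  have hp0 : (0 : ℝ) ≤ p := p.2.1
  have hn4 : (4 : ℝ) ≤ n := by exact_mod_cast hn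
  have hn0 : (0 : ℝ) < n := by linarith
  have hL0 : (0 : ℝ) < L := by exact_mod_cast hL
  have hl : 0 < Real.log n := Real.log_pos (by linarith)
  have hN0 : 0 ≤ N := by positivity
  have hρN : 32 * Real.log n ≤ ρ * N := by
    have h1 : 32 * √(n : ℝ) ≤ ρ * N := by
      refine abs_le_of_sq_le_sq' ?_ (by positivity) |>.2
      rw [mul_pow, Real.sq_sqrt hn0.le]
      linarith
    linarith [log_natCast_le_sqrt n]
  have hNlog : 32 * Real.log n ≤ N := hρN.trans (mul_le_of_le_one_left hN0 hρ1)
  have hNpos : 0 < N := by linarith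
  have hexplog : ∀ {x : ℝ} (k : ℕ), x ≤ -(k * Real.log n) → Real.exp x ≤ 1 / (n : ℝ) ^ k := by
    intro x k hx
    calc Real.exp x ≤ Real.exp (-(k * Real.log n)) := Real.exp_le_exp.mpr hx
      _ = 1 / (n : ℝ) ^ k := by
        rw [Real.exp_neg, Real.exp_nat_mul, Real.exp_log hn0, one_div]
  have hunion : ∀ E : Fin n → Set (SimpleGraph (Fin n) × Comparisons n L),
      (∀ i, μ.real (E i) ≤ 1 / (n : ℝ) ^ 2) → μ.real {ω | ∃ i, ω ∈ E i} ≤ 1 / n := by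
    intro E hE
    refine (measureReal_exists_le_sum μ E hE).trans (le_of_eq ?_)
    rw [Fintype.card_fin]
    field_simp
  have hdeg := hunion (fun i => {ω | 4 * N ≤ ∑ j, if ω.1.Adj i j then (1 : ℝ) else 0}) fun i =>
    (measure_degree_ge_le p w i).trans (hexplog 2 (by push_cast; linarith))
  have hrow := hunion (fun i => {ω | strongPairs θ ω.1 ω.2 {i} Finset.univ ≤ ρ * N / 8}) fun i => by
    refine (measure_strongPairs_le p w hρ.le hbal {i} Finset.univ _).trans (hexplog 2 ?_)
    rw [Finset.card_singleton, Finset.card_univ, Fintype.card_fin]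
    have h1 : (p : ℝ) * ρ * (n / 2) ≤ p * ρ * (n - 1) :=
      mul_le_mul_of_nonneg_left (by linarith) (by positivity)
    push_cast
    have h2 : (p : ℝ) * ρ * (n / 2) = ρ * N / 2 := by rw [hN]; ring
    linarith
  have herr := hunion (fun i => {ω | τ ≤ |balanceError w ω.1 ω.2 i|}) fun i => by
    -- This `s` minimises the exponent `N * s ^ 2 * wmax ^ 2 / L - s * τ`, whose value is then `4
    -- log n - 8 log n`.
    set s : ℝ := 2 * √(L * Real.log n / N) / wmax with hs
    have hs0 : 0 < s := by positivity
    have hsw : s ^ 2 * wmax ^ 2 = 4 * (L * Real.log n / N) := by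
      rw [hs, div_pow, mul_pow, Real.sq_sqrt (by positivity)]
      field_simp
      norm_num
    have hsτ : s * τ = 8 * Real.log n := by
      have h1 : √(L * Real.log n / N) * √(N * Real.log n / L) = Real.log n := by
        rw [← Real.sqrt_mul (by positivity),
          show L * Real.log n / N * (N * Real.log n / L) = Real.log n ^ 2 by field_simp,
          Real.sqrt_sq hl.le]
      calc s * τ = 8 * (√(L * Real.log n / N) * √(N * Real.log n / L)) := by
            rw [hs, hτ]
            field_simp
            norm_num
        _ = _ := by rw [h1]
    have hs2 : s ^ 2 * wmax ^ 2 ≤ 2 * L := by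
      rw [hsw, ← mul_div_assoc, div_le_iff₀ hNpos]
      have := mul_le_mul_of_nonneg_left hNlog hL0.le
      linarith [mul_pos hL0 hl]
    have hexpo : (p : ℝ) * (n * (s ^ 2 * wmax ^ 2 / L)) - s * τ ≤ -((4 : ℕ) * Real.log n) := by
      rw [hsτ, hsw]
      have : (p : ℝ) * (n * (4 * (L * Real.log n / N) / L)) = 4 * Real.log n := by
        rw [show (p : ℝ) * (n * (4 * (L * Real.log n / N) / L)) =
          N * (4 * (L * Real.log n / N) / L) by rw [hN]; ring]
        field_simp
      rw [this]
      push_cast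
      linarith
    have hup := (measure_balanceError_ge_le hL p hw hmax i hs2 (s * τ)).trans (hexplog 4 hexpo)
    have hdown := (measure_balanceError_ge_le hL p hw hmax i (s := -s) (by rwa [neg_sq])
      (s * τ)).trans (hexplog 4 (by rwa [neg_sq]))
    have hsub : {ω : SimpleGraph (Fin n) × Comparisons n L | τ ≤ |balanceError w ω.1 ω.2 i|} ⊆
        {ω | s * τ ≤ s * balanceError w ω.1 ω.2 i} ∪
          {ω | s * τ ≤ -s * balanceError w ω.1 ω.2 i} := by
      intro ω hω
      rcases le_abs.mp (show τ ≤ |balanceError w ω.1 ω.2 i| from hω) with h | h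
      · exact Or.inl (mul_le_mul_of_nonneg_left h hs0.le)
      · refine Or.inr ?_
        have := mul_le_mul_of_nonneg_left h hs0.le
        simp only [Set.mem_ofPred_eq]
        linarith
    calc _ ≤ 1 / (n : ℝ) ^ 4 + 1 / (n : ℝ) ^ 4 :=
          (measureReal_mono hsub).trans ((measureReal_union_le _ _).trans (add_le_add hup hdown))
      _ ≤ 1 / (n : ℝ) ^ 2 := by
          rw [← add_div, div_le_div_iff₀ (by positivity) (by positivity)]
          have : (2 : ℝ) ≤ n ^ 2 := by nlinarith
          nlinarith [sq_nonneg ((n : ℝ))]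
  have hexp : μ.real {ω | ∃ AB : Finset (Fin n) × Finset (Fin n),
      ω ∈ {ω : SimpleGraph (Fin n) × Comparisons n L | ρ * N / 8 ≤ AB.1.card ∧
        (n : ℝ) / 2 ≤ AB.2.card ∧ strongPairs θ ω.1 ω.2 AB.1 AB.2 ≤ AB.1.card * N * ρ / 16}} ≤
      1 / n := by
    have hone : ∀ AB : Finset (Fin n) × Finset (Fin n),
        μ.real {ω : SimpleGraph (Fin n) × Comparisons n L | ρ * N / 8 ≤ AB.1.card ∧
          (n : ℝ) / 2 ≤ AB.2.card ∧ strongPairs θ ω.1 ω.2 AB.1 AB.2 ≤ AB.1.card * N * ρ / 16} ≤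
        Real.exp (-(4 * n)) := by
      rintro ⟨A, B⟩
      by_cases hAB : ρ * N / 8 ≤ A.card ∧ (n : ℝ) / 2 ≤ B.card
      · refine (measureReal_mono (fun ω hω => hω.2.2)).trans
          ((measure_strongPairs_le p w hρ.le hbal A B _).trans (Real.exp_le_exp.mpr ?_))
        have h1 : (p : ℝ) * ρ * A.card * (n / 4) ≤ p * ρ * A.card * (B.card - 1) :=
          mul_le_mul_of_nonneg_left (by linarith [hAB.2]) (by positivity)
        have h2 : (p : ℝ) * ρ * A.card * (n / 4) = ρ * N * A.card / 4 := by rw [hN]; ring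
        have h3 := mul_le_mul_of_nonneg_left hAB.1 (show 0 ≤ ρ * N by positivity)
        -- The exponent is at most `-ρ N |A| / 32`, hence at most `-(ρ N) ^ 2 / 256` as `|A| ≥ ρ N /
        -- 8`; `hdense` turns this into `-4 n`.
        linarith
      · have : {ω : SimpleGraph (Fin n) × Comparisons n L | ρ * N / 8 ≤ A.card ∧
          (n : ℝ) / 2 ≤ B.card ∧ strongPairs θ ω.1 ω.2 A B ≤ A.card * N * ρ / 16} = ∅ := by
          ext ω
          simp only [Set.mem_ofPred_eq, Set.mem_empty_iff_false, iff_false]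
          exact fun h => hAB ⟨h.1, h.2.1⟩
        dsimp only
        rw [this, measureReal_empty]
        exact (Real.exp_pos _).le
    refine (measureReal_exists_le_sum μ _ hone).trans ?_
    rw [Fintype.card_prod, Fintype.card_finset, Fintype.card_fin]
    push_cast
    have h2 : (2 : ℝ) ^ n ≤ Real.exp n := by
      have := pow_le_pow_left₀ (by norm_num) (show (2 : ℝ) ≤ Real.exp 1 by
        linarith [Real.exp_one_gt_d9]) n
      rwa [← Real.exp_nat_mul, mul_one] at this
    calc (2 : ℝ) ^ n * 2 ^ n * Real.exp (-(4 * n)) ≤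
          Real.exp n * Real.exp n * Real.exp (-(4 * n)) := by gcongr
      _ = Real.exp (-(2 * n)) := by
          rw [← Real.exp_add, ← Real.exp_add]
          congr 1
          ring
      _ ≤ 1 / (n : ℝ) ^ 1 := hexplog 1 (by
          have := Real.log_le_sub_one_of_pos hn0
          push_cast
          linarith)
      _ = 1 / n := by rw [pow_one]
  have hsub : {ω : SimpleGraph (Fin n) × Comparisons n L | ¬ RegularObservation w N θ ρ τ ω.1 ω.2} ⊆
      (({ω | ∃ i, ω ∈ {ω | 4 * N ≤ ∑ j, if ω.1.Adj i j then (1 : ℝ) else 0}} ∪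
        {ω | ∃ i, ω ∈ {ω | strongPairs θ ω.1 ω.2 {i} Finset.univ ≤ ρ * N / 8}}) ∪
        {ω | ∃ i, ω ∈ {ω | τ ≤ |balanceError w ω.1 ω.2 i|}}) ∪
      {ω | ∃ AB : Finset (Fin n) × Finset (Fin n),
        ω ∈ {ω : SimpleGraph (Fin n) × Comparisons n L | ρ * N / 8 ≤ AB.1.card ∧
        (n : ℝ) / 2 ≤ AB.2.card ∧ strongPairs θ ω.1 ω.2 AB.1 AB.2 ≤ AB.1.card * N * ρ / 16}} := by
    intro ω hω
    by_contra hcon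
    simp only [Set.mem_union, Set.mem_ofPred_eq, not_or, not_exists, not_and, not_le] at hcon
    obtain ⟨⟨⟨h1, h2⟩, h3⟩, h4⟩ := hcon
    exact hω ⟨fun i => (lossSum_le _ _ i).trans (h1 i).le, fun i => (h3 i).le, fun i => (h2 i).le,
      fun A B hA hB => (h4 (A, B) hA hB).le⟩
  refine (measureReal_mono hsub).trans ((measureReal_union_le _ _).trans ((add_le_add
    ((measureReal_union_le _ _).trans (add_le_add ((measureReal_union_le _ _).trans
      (add_le_add hdeg hrow)) herr)) hexp).trans (le_of_eq ?_)))
  ring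

theorem two_mul_le_btlProb {n : ℕ} {w : Fin n → ℝ} {wmin wmax b : ℝ} (hwmin : 0 < wmin)
    (hw : ∀ i, w i ∈ Set.Icc wmin wmax) (hwb : wmax ≤ b * wmin) (hb : 1 ≤ b) (i j : Fin n) :
    2 * (1 / (2 * (1 + b))) ≤ btlProb w i j ∧
      2 * (1 / (2 * (1 + b))) ≤ 1 - (btlProb w i j : ℝ) := by
  have hw0 : ∀ i, 0 < w i := fun i => hwmin.trans_le (hw i).1
  have hle : ∀ k l, w k ≤ b * w l := fun k l =>
    (hw k).2.trans (hwb.trans (mul_le_mul_of_nonneg_left (hw l).1 (by linarith)))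
  have hpos : 0 < w i + w j := by linarith [hw0 i, hw0 j]
  rw [coe_btlProb hw0, show 1 - w i / (w i + w j) = w j / (w i + w j) by field_simp; ring,
    show 2 * (1 / (2 * (1 + b))) = 1 / (1 + b) by field_simp,
    div_le_div_iff₀ (by linarith) hpos, div_le_div_iff₀ (by linarith) hpos]
  constructor
  · linarith [hle j i]
  · linarith [hle i j]

end TopKRanking

end

/-! ### Choice of constants and conclusion -/

open TopKRanking in
theorem theorem3 :
    ∃ c₄ : ℝ, 1 < c₄ ∧ ∀ b : ℝ, 1 ≤ b → ∃ c₅ c₆ : ℝ, 0 < c₅ ∧ 0 < c₆ ∧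
      ∀ (n K L : ℕ) (p : unitInterval) (wmin wmax : ℝ) (w : Fin n → ℝ)
        (_hK : 1 ≤ K) (hKn : K < n),
        0 < wmin → wmax ≤ b * wmin → Antitone w → (∀ i, w i ∈ Set.Icc wmin wmax) →
        0 < TopKRanking.separation w wmax K hKn →
        c₄ * √(Real.log n / n) ≤ (p : ℝ) →
        ⌈c₅ * (Real.log n / (n * (p : ℝ)))⌉₊ ≤ L →
        c₆ * (n * Real.log n / TopKRanking.separation w wmax K hKn ^ 2)
          ≤ (n : ℝ) ^ 2 * (p : ℝ) * L / 2 →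
        1 - 4 * (n : ℝ) ^ (-(min 1 (3 / 28 * c₄ ^ 2)))
          ≤ (TopKRanking.observationLaw L p w).real
              {ω | TopKRanking.RankCentralityRecovers K ω.1 ω.2} := by
  -- With `c₄ = 100` the minimum defining the exponent is `1`, and `n p ^ 2 ≥ 10000 log n`.
  refine ⟨100, by norm_num, fun b hb => ?_⟩
  obtain ⟨θ, hθdef⟩ : ∃ θ : ℝ, θ = 1 / (2 * (1 + b)) := ⟨_, rfl⟩
  have hθ : 0 < θ := by rw [hθdef]; positivity
  have hθ4 : θ ≤ 1 / 4 := by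
    rw [hθdef]
    exact one_div_le_one_div_of_le (by norm_num) (by linarith)
  obtain ⟨C, hC⟩ : ∃ C : ℝ, C = 4224 * b ^ 2 / θ ^ 4 := ⟨_, rfl⟩
  have hCpos : 0 < C := by rw [hC]; positivity
  -- In `c₆`, the term `C ^ 2` gives `δ < Δ`. The exponential term forces many comparisons per pair
  -- when `n` is bounded in terms of `b`.
  refine ⟨1, C ^ 2 + Real.exp (1 / θ ^ 2) / θ ^ 2, one_pos, by positivity, ?_⟩
  intro n K L p wmin wmax w hK hKn hwmin hwb hanti hw hsep hp _ hsample
  have hw0 : ∀ i, 0 < w i := fun i => hwmin.trans_le (hw i).1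
  have hwmax : 0 < wmax := (hw0 ⟨K, hKn⟩).trans_le (hw _).2
  set Δ := separation w wmax K hKn with hΔ
  have hΔ1 : Δ ≤ 1 := by
    rw [hΔ, separation, div_le_one hwmax]
    linarith [(hw ⟨K - 1, lt_of_le_of_lt (Nat.sub_le K 1) hKn⟩).2, hw0 ⟨K, hKn⟩]
  have hn2 : 2 ≤ n := by omega
  have hn0 : (0 : ℝ) < n := by exact_mod_cast (by omega : 0 < n)
  have hp1 : (p : ℝ) ≤ 1 := p.2.2
  have hl : 1 / 2 ≤ Real.log n := by
    have h1 : Real.log 2 ≤ Real.log n := Real.log_le_log (by norm_num) (by exact_mod_cast hn2)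
    linarith [Real.log_two_gt_d9]
  have hl' : 0.69 ≤ Real.log n := by
    have h1 : Real.log 2 ≤ Real.log n := Real.log_le_log (by norm_num) (by exact_mod_cast hn2)
    linarith [Real.log_two_gt_d9]
  have hp2 : 10000 * Real.log n ≤ n * (p : ℝ) ^ 2 := by
    have h1 := pow_le_pow_left₀ (by positivity) hp 2
    rw [mul_pow, Real.sq_sqrt (by positivity)] at h1
    have h2 := mul_le_mul_of_nonneg_left h1 hn0.le
    have h3 : (n : ℝ) * (100 ^ 2 * (Real.log n / n)) = 10000 * Real.log n := by
      field_simp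
      norm_num
    linarith
  have hp0 : 0 < (p : ℝ) := lt_of_lt_of_le (by positivity) hp
  have hn4 : 4 ≤ n := by
    have h1 : (n : ℝ) * (p : ℝ) ^ 2 ≤ n :=
      mul_le_of_le_one_right hn0.le (pow_le_one₀ hp0.le hp1)
    have h2 : (4 : ℝ) ≤ n := by linarith
    exact_mod_cast h2
  have hsample' : 2 * (C ^ 2 + Real.exp (1 / θ ^ 2) / θ ^ 2) * Real.log n ≤ n * p * L * Δ ^ 2 := by
    have h1 := mul_le_mul_of_nonneg_right hsample (show 0 ≤ 2 * Δ ^ 2 by positivity)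
    refine le_of_mul_le_mul_left ?_ hn0
    calc _ = (C ^ 2 + Real.exp (1 / θ ^ 2) / θ ^ 2) * (n * Real.log n / Δ ^ 2) * (2 * Δ ^ 2) := by
          field_simp
      _ ≤ _ := h1
      _ = _ := by ring
  have hL : 1 ≤ L := by
    rcases Nat.eq_zero_or_pos L with h | h
    · rw [h] at hsample'
      have : 0 < 2 * (C ^ 2 + Real.exp (1 / θ ^ 2) / θ ^ 2) * Real.log n := by positivity
      simp only [Nat.cast_zero, mul_zero, zero_mul] at hsample'
      linarith
    · exact h
  have hL0 : (0 : ℝ) < L := by exact_mod_cast hL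
  have hbal : ∃ ρ : ℝ, θ ≤ ρ ∧ ρ ≤ 1 ∧ (∀ q, PairBalanced L w θ ρ q) ∧
      1024 ≤ 10000 * ρ ^ 2 * Real.log n := by
    have hbtl : ∀ q : Pair n, 2 * θ ≤ btlProb w q.1.1 q.1.2 ∧
        2 * θ ≤ 1 - (btlProb w q.1.1 q.1.2 : ℝ) := fun q => by
      rw [hθdef]
      exact two_mul_le_btlProb hwmin hw hwb hb _ _
    -- Since `c₄` may not depend on `b`, the density bound for `ρ = θ` comes from `log n ≥ 1 / θ ^
    -- 2`. Otherwise `n ≤ exp (1 / θ ^ 2)`, the sample size forces `L ≥ 1 / θ ^ 2`, and `ρ = 1 / 2`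
    -- is available.
    rcases le_or_gt (1 / θ ^ 2) (Real.log n) with h | h
    · refine ⟨θ, le_rfl, by linarith, fun q => pairBalanced_self hL hθ.le q (hbtl q).1 (hbtl q).2, ?_⟩
      rw [div_le_iff₀ (by positivity)] at h
      linarith
    · refine ⟨1 / 2, by linarith, by norm_num,
        fun q => pairBalanced_half hL hθ q (hbtl q).1 (hbtl q).2 ?_, by linarith⟩
      have hnexp : (n : ℝ) ≤ Real.exp (1 / θ ^ 2) := by
        rw [← Real.exp_log hn0]
        exact Real.exp_le_exp.mpr h.le
      have h1 : (n : ℝ) * p * L * Δ ^ 2 ≤ Real.exp (1 / θ ^ 2) * L := by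
        calc (n : ℝ) * p * L * Δ ^ 2 ≤ n * 1 * L * 1 := by
              gcongr
              exact pow_le_one₀ hsep.le hΔ1
          _ ≤ Real.exp (1 / θ ^ 2) * L := by
              rw [mul_one, mul_one]
              exact mul_le_mul_of_nonneg_right hnexp hL0.le
      have h2 : Real.exp (1 / θ ^ 2) / θ ^ 2 ≤
          2 * (C ^ 2 + Real.exp (1 / θ ^ 2) / θ ^ 2) * Real.log n := by
        have e1 := mul_le_mul_of_nonneg_left hl
          (show 0 ≤ 2 * (C ^ 2 + Real.exp (1 / θ ^ 2) / θ ^ 2) by positivity)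
        linarith [sq_nonneg C]
      have h3 : Real.exp (1 / θ ^ 2) * (1 / θ ^ 2) ≤ Real.exp (1 / θ ^ 2) * L := by
        rw [mul_one_div]
        linarith
      have h4 := le_of_mul_le_mul_left h3 (Real.exp_pos _)
      rw [div_le_iff₀ (by positivity)] at h4
      linarith
  obtain ⟨ρ, hθρ, hρ1, hbal, hρ⟩ := hbal
  have hρ0 : 0 < ρ := hθ.trans_le hθρ
  have hdense : 1024 * (n : ℝ) ≤ (ρ * (n * p)) ^ 2 := by
    have h1 := mul_le_mul_of_nonneg_left hp2 (show 0 ≤ ρ ^ 2 * n by positivity)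
    have h2 := mul_le_mul_of_nonneg_right hρ hn0.le
    calc 1024 * (n : ℝ) ≤ 10000 * ρ ^ 2 * Real.log n * n := h2
      _ ≤ ρ ^ 2 * n * (n * (p : ℝ) ^ 2) := by linarith
      _ = _ := by ring
  have hbad := measure_not_regularObservation_le hn4 hL p hw0 (fun i => (hw i).2) hwmax hρ0 hρ1 hbal
    hdense
  set N : ℝ := n * (p : ℝ) with hN
  have hN0 : 0 < N := by positivity
  set δ : ℝ := C * √(Real.log n / (N * L)) with hδ
  have hδ0 : 0 ≤ δ := by positivity
  have hδΔ : δ < Δ := by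
    refine lt_of_pow_lt_pow_left₀ 2 hsep.le ?_
    rw [hδ, mul_pow, Real.sq_sqrt (by positivity), ← mul_div_assoc, div_lt_iff₀ (by positivity)]
    have h1 : 0 < C ^ 2 * Real.log n := by positivity
    have h2 : 0 < Real.exp (1 / θ ^ 2) / θ ^ 2 * Real.log n := by positivity
    linarith
  -- Here `4224 = 4 * 1056`, one factor `b` comes from `wmax ≤ b * wmin`, and `θ ^ 4` in `C` absorbs
  -- `θ ^ 2 * ρ ^ 2` because `θ ≤ ρ`.
  have hδτ : 1056 * b * (4 * wmax * √(N * Real.log n / L)) ≤ δ * (θ ^ 2 * ρ ^ 2 * wmin * N) := by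
    have hsqrt : √(N * Real.log n / L) = N * √(Real.log n / (N * L)) := by
      rw [show N * Real.log n / L = N ^ 2 * (Real.log n / (N * L)) by field_simp,
        Real.sqrt_mul (sq_nonneg N), Real.sqrt_sq hN0.le]
    rw [hsqrt]
    set R := √(Real.log n / (N * L)) with hR
    have hR0 : 0 ≤ R := Real.sqrt_nonneg _
    have hρ2 : θ ^ 2 ≤ ρ ^ 2 := pow_le_pow_left₀ hθ.le hθρ 2
    calc 1056 * b * (4 * wmax * (N * R)) ≤ 1056 * b * (4 * (b * wmin) * (N * R)) := by gcongr
      _ = C * R * (θ ^ 2 * θ ^ 2 * wmin * N) := by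
          rw [hC]
          field_simp
          ring
      _ ≤ δ * (θ ^ 2 * ρ ^ 2 * wmin * N) := by
          rw [hδ]
          gcongr
  have hcover : (Set.univ : Set (SimpleGraph (Fin n) × Comparisons n L)) ⊆
      {ω | RankCentralityRecovers K ω.1 ω.2} ∪ {ω | ¬ RegularObservation w N θ ρ
        (4 * wmax * √(N * Real.log n / L)) ω.1 ω.2} := by
    intro ω _
    by_cases h : RegularObservation w N θ ρ (4 * wmax * √(N * Real.log n / L)) ω.1 ω.2
    · exact Or.inl (h.recovers hwmin hw hwb hb hN0 hθ (by linarith) hρ0 hρ1 hδτ hanti hK hKn hδ0 hδΔ)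
    · exact Or.inr h
  have htotal := (measureReal_mono (μ := observationLaw L p w) hcover).trans
    (measureReal_union_le _ _)
  rw [probReal_univ] at htotal
  have hα : min (1 : ℝ) (3 / 28 * 100 ^ 2) = 1 := min_eq_left (by norm_num)
  rw [hα, Real.rpow_neg_one, ← div_eq_mul_inv]
  linarith
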